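/- Let $k$ be an algebraically closed field. For a finite set $E$ put $k_E:=\prod_{p\in E}k$ and $k^*_E:=\prod_{p\in E}k^*$; for $F\subseteq E$ regard $k_F$ as the subspace of $k_E$ of vectors whose coordinates outside $F$ are zero. The group $k^*_E$ acts diagonally on $k_E$, hence on the Grassmannian $\mathrm{Grass}_h(k_E)$ of $h$-dimensional subspaces of $k_E$. Let $\Delta$ be a finite set, let $I$ and $J$ be non-empty subsets of $\Delta$, and let $V\subseteq k_I$ and $W\subseteq k_J$ be non-zero vector subspaces. Put $h_1:=\dim V$, $h_2:=\dim W$, $G_1:=\mathrm{Grass}_{h_1}(k_I)$ and $G_2:=\mathrm{Grass}_{h_2}(k_J)$. An ordered tripartition of a set $S$ is a triple $(S',\overline S,S'')$ of pairwise disjoint, possibly empty, subsets with union $S$. For each ordered tripartition $\mathbb I=(I',\overline I,I'')$ of $I$ and each ordered tripartition $\mathbb J=(J',\overline J,J'')$ of $J$ put \[ V_{\mathbb I}:=k_{I'}+\bigl(k_{\overline I}\cap(V+k_{I''})\bigr),\qquad W_{\mathbb J}:=k_{J'}+\bigl(k_{\overline J}\cap(W+k_{J''})\bigr). \] Let $\lambda,\tau$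 be positive integers, and let \[ T:=\{(s,t)\in k_I^*\times k_J^*\;:\; s_i^{\tau}t_j^{\lambda}=s_j^{\tau}t_i^{\lambda}\ \text{ for all } i,j\in I\cap J\}, \] which acts on $G_1\times G_2$. Assume that all Plücker coordinates of $V$ in $G_1$ and of $W$ in $G_2$ are non-zero. Then $\dim V_{\mathbb I}=h_1$ whenever $|I'|<h_1\le|I\setminus I''|$, and $\dim W_{\mathbb J}=h_2$ whenever $|J'|<h_2\le|J\setminus J''|$. Moreover, the Zariski closure in $G_1\times G_2$ of the $T$-orbit of $(V,W)$ is the union of the $T$-orbits of the points $(V_{\mathbb I},W_{\mathbb J})$, over all pairs of ordered tripartitions $\mathbb I$ of $I$ and $\mathbb J$ of $J$ that satisfy \[ |I'|<h_1\le |I\setminus I''|\quad\text{and}\quad |J'|<h_2\le|J\setminus J''| \] and the following two conditions: (a) if $I'\cap J\not\subseteq J'\cap I$ or $J''\cap I\not\subseteq I''\cap J$, then $J\cap(I\setminus I')\subseteq J''\cap I$; (b) if $J'\cap I\not\subseteq I'\cap J$ or $I''\cap J\not\subseteq J''\cap I$, then $I\cap(J\setminus J')\subseteq I''\cap J$. 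-/

import Mathlib

open Module

noncomputable section

namespace GrassOrbit

/-- The Grassmannian of `h`-dimensional vector subspaces of `k_I = k^I` (as a set of closed points). -/
abbrev Gr (k : Type*) [Field k] (ι : Type*) (h : ℕ) : Type _ :=
  {V : Submodule k (ι → k) // finrank k V = h}

section Plucker

variable {k : Type*} [Field k] {ι : Type*} [Finite ι] {h : ℕ}

/-- Plücker coordinates of a subspace of `k^ι` with respect to a basis of it: the maximal minors
of the matrix whose rows are the basis vectors.  The `h` columns are chosen by an embedding
`c : Fin h ↪ ι`, that is, by an `h`-element subset of `ι` together with an enumeration of it; a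
change of the enumeration changes the minor only by a sign. -/
def pluckerOfBasis {V : Submodule k (ι → k)} (v : Basis (Fin h) k V) (c : Fin h ↪ ι) : k :=
  Matrix.det (Matrix.of fun i j : Fin h => (v i : ι → k) (c j))

/-- Homogeneous Plücker coordinates of a point of the Grassmannian (for a chosen basis). -/
def plucker (V : Gr k ι h) (c : Fin h ↪ ι) : k :=
  pluckerOfBasis (finBasisOfFinrankEq k V.1 V.2) c

/-- Up to a common nonzero factor, the Plücker coordinates do not depend on the basis. -/
theorem exists_pluckerOfBasis_eq (V : Gr k ι h) (v : Basis (Fin h) k V.1) :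
    ∃ a : kˣ, ∀ c, pluckerOfBasis v c = a * plucker V c := by
  set w := finBasisOfFinrankEq k V.1 V.2 with hw
  refine ⟨(w.isUnit_det v).unit, fun c => ?_⟩
  have key : (Matrix.of fun i j : Fin h => (v i : ι → k) (c j)) =
      (w.toMatrix v).transpose * (Matrix.of fun i j : Fin h => (w i : ι → k) (c j)) := by
    ext i j
    have h1 := congrArg (fun x : V.1 => (x : ι → k) (c j)) (w.sum_toMatrix_smul_self v i)
    simp only [Submodule.coe_sum, Submodule.coe_smul, Finset.sum_apply, Pi.smul_apply,
      smul_eq_mul] at h1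
    simp [Matrix.mul_apply, h1]
  simp only [plucker, pluckerOfBasis, IsUnit.unit_spec, ← hw, Basis.det_apply]
  rw [key, Matrix.det_mul, Matrix.det_transpose]

end Plucker

section Zariski

variable (k : Type*) [Field k] (ι κ : Type*) [Finite ι] [Finite κ] (h₁ h₂ : ℕ)

/-- Polynomials in the two groups of Plücker coordinates that are bihomogeneous, i.e. homogeneous
of some degree `d` in the first group and of some degree `e` in the second one. -/
def IsBihomogeneous (f : MvPolynomial ((Fin h₁ ↪ ι) ⊕ (Fin h₂ ↪ κ)) k) : Prop :=
  ∃ d e : ℕ, MvPolynomial.IsWeightedHomogeneous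
    (Sum.elim (fun _ => ((1, 0) : ℕ × ℕ)) (fun _ => ((0, 1) : ℕ × ℕ))) f (d, e)

/-- The Zariski topology of the projective variety `Gr × Gr`, in its Plücker embedding into a
product of two projective spaces: a base of open sets is given by the non-vanishing loci of
bihomogeneous polynomials in the Plücker coordinates.  (It is finer than the product of the
Zariski topologies of the factors.) -/
abbrev zariski : TopologicalSpace (Gr k ι h₁ × Gr k κ h₂) :=
  TopologicalSpace.generateFrom
    {U | ∃ f : MvPolynomial ((Fin h₁ ↪ ι) ⊕ (Fin h₂ ↪ κ)) k, IsBihomogeneous k ι κ h₁ h₂ f ∧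
      U = {P | MvPolynomial.eval (Sum.elim (plucker P.1) (plucker P.2)) f ≠ 0}}

end Zariski

section Torus

variable {k : Type*} [Field k] {ι : Type*} {h : ℕ}

/-- The diagonal action of `s ∈ k*_ι` on `k_ι`. -/
def diag (s : ι → kˣ) : (ι → k) ≃ₗ[k] (ι → k) :=
  LinearEquiv.piCongrRight fun i => LinearEquiv.smulOfUnit (s i)

theorem diag_apply (s : ι → kˣ) (v : ι → k) (i : ι) : diag s v i = s i * v i := rfl

/-- The induced action of `s ∈ k*_ι` on the Grassmannian. -/
def act (s : ι → kˣ) (V : Gr k ι h) : Gr k ι h :=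
  ⟨V.1.map (diag s : (ι → k) →ₗ[k] (ι → k)), by
    rw [LinearEquiv.finrank_map_eq (diag s) V.1, V.2]⟩

end Torus

section Pair

variable {Δ : Type*}

/-- The subgroup `T` of `k*_I × k*_J` of all `(s, t)` with
`s_i ^ τ * t_j ^ λ = s_j ^ τ * t_i ^ λ` for all `i, j ∈ I ∩ J`. -/
def torus (k : Type*) [Field k] (I J : Finset Δ) (lam tau : ℕ) :
    Subgroup ((I → kˣ) × (J → kˣ)) where
  carrier := {p | ∀ (i j : Δ) (hiI : i ∈ I) (hiJ : i ∈ J) (hjI : j ∈ I) (hjJ : j ∈ J),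
    p.1 ⟨i, hiI⟩ ^ tau * p.2 ⟨j, hjJ⟩ ^ lam = p.1 ⟨j, hjI⟩ ^ tau * p.2 ⟨i, hiJ⟩ ^ lam}
  mul_mem' := by
    intro a b ha hb i j hiI hiJ hjI hjJ
    simp only [Prod.fst_mul, Prod.snd_mul, Pi.mul_apply, mul_pow]
    rw [mul_mul_mul_comm, ha i j hiI hiJ hjI hjJ, hb i j hiI hiJ hjI hjJ, mul_mul_mul_comm]
  one_mem' := by
    intro i j hiI hiJ hjI hjJ
    simp
  inv_mem' := by
    intro a ha i j hiI hiJ hjI hjJ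
    simp only [Prod.fst_inv, Prod.snd_inv, Pi.inv_apply, inv_pow]
    rw [← mul_inv, ← mul_inv, ha i j hiI hiJ hjI hjJ]

/-- The orbit of a point of `Gr × Gr` under a subgroup of `k*_I × k*_J`. -/
def orbit {k : Type*} [Field k] {I J : Finset Δ} {h₁ h₂ : ℕ}
    (T : Subgroup ((I → kˣ) × (J → kˣ))) (P : Gr k I h₁ × Gr k J h₂) :
    Set (Gr k I h₁ × Gr k J h₂) :=
  {Q | ∃ p ∈ T, Q = (act p.1 P.1, act p.2 P.2)}

/-- Ordered tripartitions `(I', Ī, I'')` of `I`; the parts may be empty. -/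
structure Tripartition [DecidableEq Δ] (I : Finset Δ) where
  /-- the first part, `I'` -/
  fst : Finset Δ
  /-- the middle part, `Ī` -/
  mid : Finset Δ
  /-- the last part, `I''` -/
  lst : Finset Δ
  disjoint_fst_mid : Disjoint fst mid
  disjoint_fst_lst : Disjoint fst lst
  disjoint_mid_lst : Disjoint mid lst
  union_eq : fst ∪ mid ∪ lst = I

/-- The subspace `k_E` of `k_I`: the vectors whose coordinates outside `E` vanish. -/
def coordSubspace (k : Type*) [Field k] (I E : Finset Δ) : Submodule k (I → k) where
  carrier := {v | ∀ i : I, (i : Δ) ∉ E → v i = 0}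
  add_mem' := by
    intro a b ha hb i hi
    simp [ha i hi, hb i hi]
  zero_mem' := by
    intro i _
    rfl
  smul_mem' := by
    intro c a ha i hi
    simp [ha i hi]

variable [DecidableEq Δ]

/-- The subspace `V_𝕀 = k_{I'} + (k_Ī ∩ (V + k_{I''}))` attached to `V` and `𝕀 = (I', Ī, I'')`. -/
def degeneration {k : Type*} [Field k] {I : Finset Δ} (V : Submodule k (I → k))
    (A : Tripartition I) : Submodule k (I → k) :=
  coordSubspace k I A.fst ⊔ (coordSubspace k I A.mid ⊓ (V ⊔ coordSubspace k I A.lst))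

/-- The cardinality bounds `|I'| < h ≤ |I - I''|`. -/
def Tripartition.Bounds {I : Finset Δ} (A : Tripartition I) (h : ℕ) : Prop :=
  A.fst.card < h ∧ h ≤ (I \ A.lst).card

/-- The two compatibility conditions between a tripartition `(I', Ī, I'')` of `I` and a
tripartition `(J', J̄, J'')` of `J`. -/
def Compatible {I J : Finset Δ} (A : Tripartition I) (B : Tripartition J) : Prop :=
  ((¬ A.fst ∩ J ⊆ B.fst ∩ I ∨ ¬ B.lst ∩ I ⊆ A.lst ∩ J) → J ∩ (I \ A.fst) ⊆ B.lst ∩ I) ∧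
  ((¬ B.fst ∩ I ⊆ A.fst ∩ J ∨ ¬ A.lst ∩ J ⊆ B.lst ∩ I) → I ∩ (J \ B.fst) ⊆ A.lst ∩ J)

end Pair

end GrassOrbit

end

open GrassOrbit

/-!
A tripartition is cut out by a weight `a` on `Δ` and a threshold, and the limit of `z ^ a · V` as
`z → 0` is the degeneration of `V` at this tripartition. Two tripartitions are compatible exactly
when they come from a common weight, with one threshold each. Since
`z ↦ (z ^ (λ a), z ^ (τ a))` is a one-parameter subgroup of `T`, all degenerations at compatible
tripartitions lie in the closure of the orbit.

Conversely, monomials in the Plücker coordinates of the same bidegree on which `T` acts by the same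
character are proportional on the orbit, hence on its closure. For a point of the closure, the
quotients of its Plücker coordinates by those of `(V, W)` therefore satisfy binomial relations of
two kinds. Those from an exchange of elements between two sets of columns of the same factor show
that the quotients are non-zero exactly at the sets of columns `S` with `I' ⊆ S ⊆ I \ I''` for some
tripartition, and are monomials `α ∏ i ∈ S, s i` there. Those from opposite exchanges in the two
factors make the two tripartitions compatible and allow the scalings to be chosen in `T`.
-/

open Module

noncomputable section

namespace GrassOrbit

section PluckerVector

variable {k : Type*} [Field k] {ι : Type*} {h : ℕ}

/-- The vectors `v i` are dual to the coordinates chosen by `c`: on these columns, the matrix with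
rows `v i` is the identity matrix. -/
def IsReduced (v : Fin h → ι → k) (c : Fin h ↪ ι) : Prop :=
  ∀ i j, v i (c j) = (1 : Matrix (Fin h) (Fin h) k) i j

theorem IsReduced.det_eq_one {v : Fin h → ι → k} {c : Fin h ↪ ι} (hv : IsReduced v c) :
    Matrix.det (Matrix.of fun i j => v i (c j)) = 1 := by
  rw [← Matrix.det_one (n := Fin h)]
  exact congrArg Matrix.det (Matrix.ext hv)

open scoped Classical in
/-- By Cramer's rule, the entries of a reduced matrix are among its maximal minors. -/
theorem IsReduced.det_setValue {v : Fin h → ι → k} {c : Fin h ↪ ι} (hv : IsReduced v c)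
    (i : Fin h) {j : ι} (hj : j ∉ Set.range c) :
    Matrix.det (Matrix.of fun a b => v a (c.setValue i j b)) = v i j := by
  have hcramer := Matrix.cramer_apply (1 : Matrix (Fin h) (Fin h) k) (fun a => v a j) i
  rw [Matrix.cramer_one, Module.End.one_apply] at hcramer
  rw [hcramer]
  congr 1
  ext a b
  rw [Matrix.of_apply, Matrix.updateCol_apply]
  split_ifs with hb
  · rw [hb, Function.Embedding.setValue_eq]
  · rw [Function.Embedding.setValue_eq_of_ne hb fun hcb => hj ⟨b, hcb⟩, hv]

theorem span_range_coe_basis {X : Submodule k (ι → k)} (v : Basis (Fin h) k X) :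
    Submodule.span k (Set.range fun i => (v i : ι → k)) = X := by
  have hspan := congrArg (Submodule.map X.subtype) v.span_eq
  rwa [Submodule.map_span, Submodule.map_top, Submodule.range_subtype, ← Set.range_comp] at hspan

theorem IsReduced.eq_of_pluckerOfBasis_eq {X X' : Submodule k (ι → k)} {v : Basis (Fin h) k X}
    {v' : Basis (Fin h) k X'} {c : Fin h ↪ ι} (hv : IsReduced (fun i => (v i : ι → k)) c)
    (hv' : IsReduced (fun i => (v' i : ι → k)) c)
    (heq : ∀ c', pluckerOfBasis v c' = pluckerOfBasis v' c') : X = X' := by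
  classical
  rw [← span_range_coe_basis v, ← span_range_coe_basis v']
  congr 2
  ext i j
  by_cases hj : j ∈ Set.range c
  · obtain ⟨l, rfl⟩ := hj
    exact (hv i l).trans (hv' i l).symm
  · exact (hv.det_setValue i hj).symm.trans ((heq _).trans (hv'.det_setValue i hj))

theorem exists_basis_coe_eq {X : Submodule k (ι → k)} {w : Fin h → ι → k} {c : Fin h ↪ ι}
    (hw : IsReduced w c) (hwX : ∀ i, w i ∈ X) (hX : ∀ x ∈ X, (∀ i, x (c i) = 0) → x = 0) :
    ∃ b : Basis (Fin h) k X, ∀ i, (b i : ι → k) = w i := by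
  let e : X ≃ₗ[k] (Fin h → k) := LinearEquiv.ofBijective
    (LinearMap.funLeft k k c ∘ₗ X.subtype) ⟨by
      rw [← LinearMap.ker_eq_bot, LinearMap.ker_eq_bot']
      exact fun x hx => Subtype.ext (hX x x.2 (congrFun hx)), fun y =>
        ⟨∑ i, y i • ⟨w i, hwX i⟩, by
          ext j
          simp [LinearMap.funLeft_apply, hw _ j, Matrix.one_apply]⟩⟩
  refine ⟨Basis.ofEquivFun e, fun i => ?_⟩
  have hi : (⟨w i, hwX i⟩ : X) = e.symm (Pi.single i 1) := by
    rw [LinearEquiv.eq_symm_apply]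
    ext j
    exact (hw i j).trans Matrix.one_eq_pi_single
  rw [Basis.coe_ofEquivFun]
  exact congrArg Subtype.val hi.symm

/-- The weight of the Plücker coordinate indexed by `c` under the diagonal torus, as a character
evaluated at `s`. -/
def torusChar (s : ι → kˣ) (c : Fin h ↪ ι) : kˣ :=
  ∏ i, s (c i)

theorem torusChar_mul (s t : ι → kˣ) (c : Fin h ↪ ι) :
    torusChar (s * t) c = torusChar s c * torusChar t c :=
  Finset.prod_mul_distrib

variable [Finite ι]

theorem eq_zero_of_plucker_ne_zero {V : Gr k ι h} {c : Fin h ↪ ι} (hc : plucker V c ≠ 0)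
    {x : ι → k} (hx : x ∈ V.1) (hxc : ∀ i, x (c i) = 0) : x = 0 := by
  let w := finBasisOfFinrankEq k V.1 V.2
  have hrepr : ⇑(w.repr ⟨x, hx⟩) = 0 := Matrix.eq_zero_of_vecMul_eq_zero hc (by
    ext j
    have hsum := congrArg (fun y : V.1 => (y : ι → k) (c j)) (w.sum_repr ⟨x, hx⟩)
    simp only [Submodule.coe_sum, Submodule.coe_smul, Finset.sum_apply, Pi.smul_apply,
      smul_eq_mul, hxc] at hsum
    exact hsum)
  exact congrArg Subtype.val
    (w.repr.map_eq_zero_iff.1 (DFunLike.coe_injective hrepr) : (⟨x, hx⟩ : V.1) = 0)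

theorem exists_reduced_basis (V : Gr k ι h) {c : Fin h ↪ ι} (hc : plucker V c ≠ 0) :
    ∃ v : Basis (Fin h) k V.1, IsReduced (fun i => (v i : ι → k)) c := by
  let f : V.1 →ₗ[k] (Fin h → k) := LinearMap.funLeft k k c ∘ₗ V.1.subtype
  have hf : Function.Injective f := by
    rw [← LinearMap.ker_eq_bot, LinearMap.ker_eq_bot']
    exact fun x hx => Subtype.ext (eq_zero_of_plucker_ne_zero hc x.2 (congrFun hx))
  let e := f.linearEquivOfInjective hf (by simp [V.2])
  refine ⟨Basis.ofEquivFun e, fun i j => ?_⟩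
  have hij : e (Basis.ofEquivFun e i) j = (Pi.single i 1 : Fin h → k) j := by simp
  rw [Matrix.one_eq_pi_single]
  exact hij

theorem exists_plucker_ne_zero (V : Gr k ι h) : ∃ c, plucker V c ≠ 0 := by
  have := Fintype.ofFinite ι
  let w := finBasisOfFinrankEq k V.1 V.2
  let M : Matrix (Fin h) ι k := Matrix.of fun i j => (w i : ι → k) j
  have hrank : M.rank = h := by
    have hli : LinearIndependent k M.row :=
      w.linearIndependent.map' V.1.subtype (Submodule.ker_subtype _)
    simpa using hli.rank_matrix
  obtain ⟨κ, a, hinj, hspan, hind⟩ := exists_linearIndependent' k M.col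
  have : Finite κ := Finite.of_injective a hinj
  have := Fintype.ofFinite κ
  have hcard : Fintype.card κ = h := by
    rw [← finrank_span_eq_card hind, hspan, ← Matrix.rank_eq_finrank_span_cols, hrank]
  let e : Fin h ≃ κ := (Fintype.equivFinOfCardEq hcard).symm
  have hcol : LinearIndependent k (M.submatrix id (a ∘ e)).col := hind.comp e e.injective
  have hunit := Matrix.linearIndependent_cols_iff_isUnit.1 hcol
  exact ⟨⟨a ∘ e, hinj.comp e.injective⟩, ((Matrix.isUnit_iff_isUnit_det _).1 hunit).ne_zero⟩

theorem plucker_perm_trans (V : Gr k ι h) (σ : Equiv.Perm (Fin h)) (c : Fin h ↪ ι) :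
    plucker V (σ.toEmbedding.trans c) = (Equiv.Perm.sign σ : ℤ) * plucker V c :=
  Matrix.det_permute' σ (Matrix.of fun i j => (finBasisOfFinrankEq k V.1 V.2 i : ι → k) (c j))

/-- `x` is a vector of homogeneous Plücker coordinates of `V`. The function `plucker V` is one of
them, but depends on a choice of basis that the torus action does not respect. -/
def IsPluckerVector (V : Gr k ι h) (x : (Fin h ↪ ι) → k) : Prop :=
  ∃ a : kˣ, ∀ c, plucker V c = a * x c

theorem isPluckerVector_plucker (V : Gr k ι h) : IsPluckerVector V (plucker V) :=
  ⟨1, fun c => by rw [Units.val_one, one_mul]⟩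

theorem isPluckerVector_pluckerOfBasis (V : Gr k ι h) (v : Basis (Fin h) k V.1) :
    IsPluckerVector V (pluckerOfBasis v) := by
  obtain ⟨a, ha⟩ := exists_pluckerOfBasis_eq V v
  exact ⟨a⁻¹, fun c => by rw [ha, Units.inv_mul_cancel_left]⟩

theorem IsPluckerVector.units_mul {V : Gr k ι h} {x : (Fin h ↪ ι) → k} (hx : IsPluckerVector V x)
    (b : kˣ) : IsPluckerVector V (fun c => b * x c) := by
  obtain ⟨a, ha⟩ := hx
  exact ⟨a * b⁻¹, fun c => by rw [ha, Units.val_mul, mul_assoc, Units.inv_mul_cancel_left]⟩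

theorem IsPluckerVector.eq {V V' : Gr k ι h} {x : (Fin h ↪ ι) → k} (hx : IsPluckerVector V x)
    (hx' : IsPluckerVector V' x) : V = V' := by
  obtain ⟨a, ha⟩ := hx
  obtain ⟨a', ha'⟩ := hx'
  obtain ⟨c, hc⟩ := exists_plucker_ne_zero V
  have hxc : x c ≠ 0 := right_ne_zero_of_mul (ha c ▸ hc)
  obtain ⟨v, hv⟩ := exists_reduced_basis V hc
  obtain ⟨v', hv'⟩ := exists_reduced_basis V' (ha' c ▸ mul_ne_zero a'.ne_zero hxc)
  obtain ⟨b, hb⟩ := exists_pluckerOfBasis_eq V v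
  obtain ⟨b', hb'⟩ := exists_pluckerOfBasis_eq V' v'
  have hfactor : (b * a : k) = b' * a' := mul_right_cancel₀ hxc (by
    rw [mul_assoc, mul_assoc, ← ha, ← ha', ← hb, ← hb']
    exact hv.det_eq_one.trans hv'.det_eq_one.symm)
  refine Subtype.ext (hv.eq_of_pluckerOfBasis_eq hv' fun c' => ?_)
  rw [hb, hb', ha, ha', ← mul_assoc, ← mul_assoc, hfactor]

theorem IsPluckerVector.act {V : Gr k ι h} {x : (Fin h ↪ ι) → k} (hx : IsPluckerVector V x)
    (s : ι → kˣ) : IsPluckerVector (act s V) (fun c => torusChar s c * x c) := by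
  obtain ⟨a, ha⟩ := hx
  let w : Basis (Fin h) k (GrassOrbit.act s V).1 :=
    (finBasisOfFinrankEq k V.1 V.2).map ((diag s).submoduleMap V.1)
  have hminor : ∀ c, pluckerOfBasis w c = torusChar s c * plucker V c := fun c => by
    rw [torusChar, Units.coe_prod]
    exact Matrix.det_mul_row (fun j => (s (c j) : k)) _
  obtain ⟨b, hb⟩ := isPluckerVector_pluckerOfBasis _ w
  refine ⟨b * a, fun c => ?_⟩
  rw [hb, hminor, ha, Units.val_mul]
  ring

end PluckerVector

section Columns

variable {Δ : Type*} {I : Finset Δ} {h : ℕ}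

/-- The `h`-element subset of `I` underlying a choice of `h` columns. -/
def cols (c : Fin h ↪ I) : Finset Δ :=
  Finset.univ.map (c.trans (Function.Embedding.subtype _))

theorem mem_cols {c : Fin h ↪ I} {x : Δ} : x ∈ cols c ↔ ∃ i, (c i : Δ) = x := by
  simp [cols]

theorem cols_subset (c : Fin h ↪ I) : cols c ⊆ I := fun _ hx => by
  obtain ⟨i, rfl⟩ := mem_cols.1 hx
  exact (c i).2

theorem card_cols (c : Fin h ↪ I) : (cols c).card = h := by
  simp [cols]

@[to_additive]
theorem prod_cols {M : Type*} [CommMonoid M] (c : Fin h ↪ I) (f : Δ → M) :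
    ∏ x ∈ cols c, f x = ∏ i, f (c i) := by
  simp [cols]

theorem exists_cols_eq {S : Finset Δ} (hS : S ⊆ I) (hcard : S.card = h) :
    ∃ c : Fin h ↪ I, cols c = S := by
  refine ⟨(S.equivFinOfCardEq hcard).symm.toEmbedding.trans
    (Subtype.impEmbedding (· ∈ S) (· ∈ I) hS), ?_⟩
  ext x
  rw [mem_cols]
  exact (S.equivFinOfCardEq hcard).symm.exists_congr_left.trans (by simp)

theorem exists_perm_trans_eq {c c' : Fin h ↪ I} (hc : cols c = cols c') :
    ∃ σ : Equiv.Perm (Fin h), σ.toEmbedding.trans c = c' := by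
  have hmem : ∀ i, ∃ j, c j = c' i := fun i => by
    obtain ⟨j, hj⟩ := mem_cols.1 (hc.symm ▸ mem_cols.2 ⟨i, rfl⟩ : (c' i : Δ) ∈ cols c)
    exact ⟨j, Subtype.ext hj⟩
  choose σ hσ using hmem
  have hinj : Function.Injective σ := fun i j hij => c'.injective (by rw [← hσ, hij, hσ])
  exact ⟨Equiv.ofBijective σ (Finite.injective_iff_bijective.1 hinj),
    Function.Embedding.ext hσ⟩

variable {k : Type*} [Field k]

/-- The coordinatewise quotient of the Plücker coordinates of `V'` by those of `V`, as a function
of the underlying set of columns; it is `0` at sets that are not `h`-element subsets of `I`. -/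
def pluckerRatio (V V' : Gr k I h) : Finset Δ → k :=
  Function.extend cols (fun c => plucker V' c / plucker V c) 0

/-- The sign of a reordering of the columns cancels in the quotient. -/
theorem plucker_div_factorsThrough (V V' : Gr k I h) :
    Function.FactorsThrough (fun c => plucker V' c / plucker V c) (cols (I := I)) := by
  intro c c' hc
  obtain ⟨σ, rfl⟩ := exists_perm_trans_eq hc
  have hσ : ((Equiv.Perm.sign σ : ℤ) : k) ≠ 0 := by
    rcases Int.units_eq_one_or (Equiv.Perm.sign σ) with hs | hs <;> simp [hs]
  simp only [plucker_perm_trans, mul_div_mul_left _ _ hσ]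

theorem pluckerRatio_cols (V V' : Gr k I h) (c : Fin h ↪ I) :
    pluckerRatio V V' (cols c) = plucker V' c / plucker V c :=
  (plucker_div_factorsThrough V V').extend_apply 0 c

theorem exists_cols_of_pluckerRatio_ne_zero {V V' : Gr k I h} {S : Finset Δ}
    (hS : pluckerRatio V V' S ≠ 0) : ∃ c : Fin h ↪ I, cols c = S := by
  by_contra hc
  exact hS (Function.extend_apply' _ _ _ hc)

end Columns

section Tripartition

variable {Δ : Type*} [DecidableEq Δ] {I : Finset Δ} {A : Tripartition I}

namespace Tripartition

theorem mem_cases (A : Tripartition I) {i : Δ} (hi : i ∈ I) :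
    i ∈ A.fst ∨ i ∈ A.mid ∨ i ∈ A.lst := by
  rw [← A.union_eq] at hi
  simpa [or_assoc] using hi

theorem fst_subset (A : Tripartition I) : A.fst ⊆ I :=
  fun _ hx => A.union_eq ▸ by simp [hx]

theorem mid_subset (A : Tripartition I) : A.mid ⊆ I :=
  fun _ hx => A.union_eq ▸ by simp [hx]

theorem lst_subset (A : Tripartition I) : A.lst ⊆ I :=
  fun _ hx => A.union_eq ▸ by simp [hx]

theorem notMem_lst_of_mem_fst {i : Δ} (hi : i ∈ A.fst) : i ∉ A.lst :=
  Finset.disjoint_left.1 A.disjoint_fst_lst hi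

theorem mem_mid_iff {i : Δ} (hi : i ∈ I) : i ∈ A.mid ↔ i ∉ A.fst ∧ i ∉ A.lst :=
  ⟨fun hm => ⟨Finset.disjoint_right.1 A.disjoint_fst_mid hm,
    Finset.disjoint_left.1 A.disjoint_mid_lst hm⟩, fun hn => by
      simpa [hn.1, hn.2] using A.mem_cases hi⟩

/-- `S` lies between the first part of `A` and the complement of its last part. The `h`-element
sets with this property index the non-zero Plücker coordinates of a degeneration. -/
def Between (A : Tripartition I) (S : Finset Δ) : Prop :=
  A.fst ⊆ S ∧ S ⊆ I \ A.lst

theorem Between.notMem_lst {S : Finset Δ} (hS : A.Between S) {i : Δ} (hi : i ∈ S) : i ∉ A.lst :=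
  (Finset.mem_sdiff.1 (hS.2 hi)).2

theorem Bounds.exists_cols {h : ℕ} (hA : A.Bounds h) :
    ∃ c : Fin h ↪ I, A.Between (cols c) := by
  obtain ⟨S, hfst, hlst, hcard⟩ := Finset.exists_subsuperset_card_eq
    (fun i hi => Finset.mem_sdiff.2 ⟨A.fst_subset hi, notMem_lst_of_mem_fst hi⟩) hA.1.le hA.2
  obtain ⟨c, rfl⟩ := exists_cols_eq (hlst.trans Finset.sdiff_subset) hcard
  exact ⟨c, hfst, hlst⟩

/-- `a` is a weight whose sublevel, level and superlevel sets at `θ` are the parts of `A`. -/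
def IsWeight (A : Tripartition I) (a : Δ → ℕ) (θ : ℕ) : Prop :=
  (∀ i ∈ A.fst, a i < θ) ∧ (∀ i ∈ A.mid, a i = θ) ∧ (∀ i ∈ A.lst, θ < a i)

theorem IsWeight.const_mul {a : Δ → ℕ} {θ : ℕ} (ha : A.IsWeight a θ) {m : ℕ} (hm : 0 < m) :
    A.IsWeight (fun i => m * a i) (m * θ) :=
  ⟨fun i hi => Nat.mul_lt_mul_of_pos_left (ha.1 i hi) hm,
    fun i hi => congrArg (m * ·) (ha.2.1 i hi),
    fun i hi => Nat.mul_lt_mul_of_pos_left (ha.2.2 i hi) hm⟩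

theorem IsWeight.le {a : Δ → ℕ} {θ : ℕ} (ha : A.IsWeight a θ) {i : Δ} (hi : i ∈ I)
    (hl : i ∉ A.lst) : a i ≤ θ := by
  rcases A.mem_cases hi with hf | hm | hl'
  · exact (ha.1 i hf).le
  · exact (ha.2.1 i hm).le
  · exact absurd hl' hl

theorem IsWeight.ge {a : Δ → ℕ} {θ : ℕ} (ha : A.IsWeight a θ) {i : Δ} (hi : i ∈ I)
    (hf : i ∉ A.fst) : θ ≤ a i := by
  rcases A.mem_cases hi with hf' | hm | hl
  · exact absurd hf' hf
  · exact (ha.2.1 i hm).ge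
  · exact (ha.2.2 i hl).le

/-- The standard weight of `A`, with values `0`, `1`, `2` on the three parts. -/
def level (A : Tripartition I) (i : Δ) : ℕ :=
  if i ∈ A.fst then 0 else if i ∈ A.lst then 2 else 1

theorem isWeight_level (A : Tripartition I) : A.IsWeight A.level 1 := by
  refine ⟨fun i hi => ?_, fun i hi => ?_, fun i hi => ?_⟩
  · simp [level, hi]
  · simp [level, ((A.mem_mid_iff (A.mid_subset hi)).1 hi)]
  · simp [level, Finset.disjoint_right.1 A.disjoint_fst_lst hi, hi]

section MinimalWeight

variable {a : Δ → ℕ} {θ : ℕ} {S₀ S : Finset Δ}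

theorem IsWeight.le_of_mem_sdiff (ha : A.IsWeight a θ) (hS₀ : A.Between S₀) :
    ∀ i ∈ S₀ \ S, a i ≤ θ := fun _ hi =>
  have hi₀ := hS₀.2 (Finset.mem_sdiff.1 hi).1
  ha.le (Finset.sdiff_subset hi₀) (Finset.mem_sdiff.1 hi₀).2

theorem IsWeight.ge_of_mem_sdiff (ha : A.IsWeight a θ) (hS₀ : A.Between S₀) (hS : S ⊆ I) :
    ∀ i ∈ S \ S₀, θ ≤ a i := fun _ hi =>
  ha.ge (hS (Finset.mem_sdiff.1 hi).1) fun hf => (Finset.mem_sdiff.1 hi).2 (hS₀.1 hf)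

theorem IsWeight.sum_sdiff_le (ha : A.IsWeight a θ) (hS₀ : A.Between S₀) :
    ∑ i ∈ S₀ \ S, a i ≤ (S₀ \ S).card * θ :=
  Finset.sum_le_card_nsmul _ _ _ (ha.le_of_mem_sdiff hS₀)

theorem IsWeight.le_sum_sdiff (ha : A.IsWeight a θ) (hS₀ : A.Between S₀) (hS : S ⊆ I)
    (hcard : S₀.card = S.card) : (S₀ \ S).card * θ ≤ ∑ i ∈ S \ S₀, a i := by
  rw [Finset.card_sdiff_comm hcard]
  exact Finset.card_nsmul_le_sum _ _ _ (ha.ge_of_mem_sdiff hS₀ hS)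

theorem IsWeight.sum_le_sum (ha : A.IsWeight a θ) (hS₀ : A.Between S₀) (hS : S ⊆ I)
    (hcard : S₀.card = S.card) : ∑ i ∈ S₀, a i ≤ ∑ i ∈ S, a i :=
  Finset.sum_sdiff_le_sum_sdiff.1 ((ha.sum_sdiff_le hS₀).trans (ha.le_sum_sdiff hS₀ hS hcard))

theorem IsWeight.sum_eq_sum_iff (ha : A.IsWeight a θ) (hS₀ : A.Between S₀) (hS : S ⊆ I)
    (hcard : S₀.card = S.card) : ∑ i ∈ S₀, a i = ∑ i ∈ S, a i ↔ A.Between S := by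
  have hlow := ha.sum_sdiff_le (S := S) hS₀
  have hhigh := ha.le_sum_sdiff hS₀ hS hcard
  rw [← Finset.sum_sdiff_eq_sum_sdiff_iff]
  constructor
  · intro heq
    have hθ₀ : ∀ i ∈ S₀ \ S, a i = θ :=
      (Finset.sum_eq_sum_iff_of_le (ha.le_of_mem_sdiff hS₀)).1
        ((heq ▸ hhigh).antisymm' hlow |>.trans (Finset.sum_const_nat fun _ _ => rfl).symm)
    have hθ : ∀ i ∈ S \ S₀, θ = a i :=
      (Finset.sum_eq_sum_iff_of_le (ha.ge_of_mem_sdiff hS₀ hS)).1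
        ((Finset.sum_const_nat fun _ _ => rfl).trans
          (Finset.card_sdiff_comm hcard ▸ (heq ▸ hlow).antisymm hhigh |>.symm))
    refine ⟨fun i hi => ?_, fun i hi => Finset.mem_sdiff.2 ⟨hS hi, fun hl => ?_⟩⟩
    · by_contra hiS
      exact (ha.1 i hi).ne (hθ₀ i (Finset.mem_sdiff.2 ⟨hS₀.1 hi, hiS⟩))
    · exact (ha.2.2 i hl).ne
        (hθ i (Finset.mem_sdiff.2 ⟨hi, fun hi₀ => hS₀.notMem_lst hi₀ hl⟩))
  · intro hSA
    refine hlow.antisymm ?_ |>.trans (hhigh.antisymm ?_)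
    · exact Finset.card_nsmul_le_sum _ _ _
        (ha.ge_of_mem_sdiff hSA (hS₀.2.trans Finset.sdiff_subset))
    · rw [Finset.card_sdiff_comm hcard]
      exact ha.sum_sdiff_le hSA

end MinimalWeight

end Tripartition

end Tripartition

section InitialForms

/-- Minimal-weight part of a determinant: in the Leibniz formula, the condition `a i ≤ b (σ i)` for
all `i` forces equality throughout as soon as the total weights agree. -/
theorem det_of_weight_eq {n R : Type*} [Fintype n] [DecidableEq n] [CommRing R] (M : Matrix n n R)
    {a b : n → ℕ} (hM : ∀ i j, M i j ≠ 0 → a i ≤ b j) :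
    Matrix.det (Matrix.of fun i j => if b j = a i then M i j else 0) =
      if ∑ i, a i = ∑ j, b j then M.det else 0 := by
  have hterm : ∀ σ : Equiv.Perm n, (∏ j, if b j = a (σ j) then M (σ j) j else 0) =
      if ∑ i, a i = ∑ j, b j then ∏ j, M (σ j) j else 0 := by
    intro σ
    rw [← Equiv.sum_comp σ a]
    by_cases hprod : ∃ j, M (σ j) j = 0
    · obtain ⟨j, hj⟩ := hprod
      rw [Finset.prod_eq_zero (Finset.mem_univ j) (by rw [hj, ite_self]),
        Finset.prod_eq_zero (f := fun j => M (σ j) j) (Finset.mem_univ j) hj, ite_self]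
    · push Not at hprod
      rw [Finset.prod_ite_zero]
      simp only [Finset.sum_eq_sum_iff_of_le fun j _ => hM (σ j) j (hprod j), eq_comm]
      congr
  rw [Matrix.det_apply, Matrix.det_apply]
  simp only [Matrix.of_apply, hterm]
  split_ifs
  · rfl
  · simp only [smul_zero, Finset.sum_const_zero]

variable {Δ : Type*} [DecidableEq Δ] {I : Finset Δ} {A : Tripartition I}
  {k : Type*} [Field k] {h : ℕ} {c : Fin h ↪ I} {v : Fin h → I → k}

theorem Tripartition.Between.mem_fst_or_mem_mid (hc : A.Between (cols c)) (i : Fin h) :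
    (c i : Δ) ∈ A.fst ∨ (c i : Δ) ∈ A.mid := by
  have hi := hc.notMem_lst (mem_cols.2 ⟨i, rfl⟩)
  simpa [hi] using A.mem_cases (c i).2

theorem Tripartition.Between.exists_eq_of_mem_fst (hc : A.Between (cols c)) {j : I}
    (hj : (j : Δ) ∈ A.fst) : ∃ l, c l = j := by
  obtain ⟨l, hl⟩ := mem_cols.1 (hc.1 hj)
  exact ⟨l, Subtype.ext hl⟩

/-- The part of the vector `v i` on the part of `A` containing `c i`, that is, its initial form with
respect to `A.level`. -/
def initialForm (A : Tripartition I) (c : Fin h ↪ I) (v : Fin h → I → k) (i : Fin h) (j : I) : k :=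
  if A.level j = A.level (c i) then v i j else 0

theorem IsReduced.initialForm (hv : IsReduced v c) : IsReduced (initialForm A c v) c := by
  intro i j
  rw [GrassOrbit.initialForm, hv]
  by_cases hij : i = j
  · rw [hij, if_pos rfl]
  · rw [Matrix.one_apply_ne hij, ite_self]

theorem IsReduced.level_le (hv : IsReduced v c) (hc : A.Between (cols c)) {i : Fin h} {j : I}
    (hij : v i j ≠ 0) : A.level (c i) ≤ A.level j := by
  by_cases hj : (j : Δ) ∈ A.fst
  · obtain ⟨l, rfl⟩ := hc.exists_eq_of_mem_fst hj
    rw [hv] at hij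
    rw [not_imp_comm.1 Matrix.one_apply_ne hij]
  · exact (A.isWeight_level.le (c i).2 (hc.notMem_lst (mem_cols.2 ⟨i, rfl⟩))).trans
      (A.isWeight_level.ge j.2 hj)

theorem initialForm_mem {V : Submodule k (I → k)} (hv : IsReduced v c) (hvV : ∀ i, v i ∈ V)
    (hc : A.Between (cols c)) (i : Fin h) : initialForm A c v i ∈ degeneration V A := by
  obtain ⟨hfst, hmid, hlst⟩ := A.isWeight_level
  rcases hc.mem_fst_or_mem_mid i with hi | hi
  · refine Submodule.mem_sup_left fun j hj => if_neg ?_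
    exact ((hfst _ hi).trans_le (A.isWeight_level.ge j.2 hj)).ne'
  · refine Submodule.mem_sup_right ⟨fun j hj => if_neg ?_, ?_⟩
    · rw [hmid _ hi]
      rcases A.mem_cases j.2 with hj' | hj' | hj'
      · exact (hfst _ hj').ne
      · exact absurd hj' hj
      · exact (hlst _ hj').ne'
    · rw [← add_sub_cancel (v i) (initialForm A c v i)]
      refine Submodule.add_mem_sup (hvV i) fun j hj =>
        sub_eq_zero.2 (ite_eq_left_iff.2 fun hne => ?_)
      by_contra hij
      exact hne (((A.isWeight_level.le j.2 hj).trans (hmid _ hi).ge).antisymm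
        (hv.level_le hc (Ne.symm hij)))

theorem eq_zero_of_mem_degeneration {V : Submodule k (I → k)}
    (hV : ∀ x ∈ V, (∀ i, x (c i) = 0) → x = 0) (hc : A.Between (cols c)) {x : I → k}
    (hx : x ∈ degeneration V A) (hxc : ∀ i, x (c i) = 0) : x = 0 := by
  obtain ⟨y, hy, z, ⟨hz, hz'⟩, rfl⟩ := Submodule.mem_sup.1 hx
  obtain ⟨u, hu, l, hl, rfl⟩ := Submodule.mem_sup.1 hz'
  have huc : ∀ i, u (c i) = 0 := fun i => by
    have hli := hl (c i) (hc.notMem_lst (mem_cols.2 ⟨i, rfl⟩))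
    rcases hc.mem_fst_or_mem_mid i with hi | hi
    · have hzi := hz (c i) (Finset.disjoint_left.1 A.disjoint_fst_mid hi)
      rwa [Pi.add_apply, hli, add_zero] at hzi
    · have hyi := hy (c i) (Finset.disjoint_right.1 A.disjoint_fst_mid hi)
      have hxi := hxc i
      rwa [Pi.add_apply, Pi.add_apply, hyi, hli, zero_add, add_zero] at hxi
  obtain rfl := hV u hu huc
  rw [zero_add] at hz hxc ⊢
  obtain rfl : l = 0 := funext fun j => by
    by_cases hj : (j : Δ) ∈ A.mid
    · exact hl j (Finset.disjoint_left.1 A.disjoint_mid_lst hj)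
    · exact hz j hj
  rw [add_zero] at hxc ⊢
  funext j
  by_cases hj : (j : Δ) ∈ A.fst
  · obtain ⟨i, rfl⟩ := hc.exists_eq_of_mem_fst hj
    exact hxc i
  · exact hy j hj

theorem exists_basis_degeneration {V : Gr k I h} (hVc : plucker V c ≠ 0)
    (hc : A.Between (cols c)) {v : Basis (Fin h) k V.1}
    (hv : IsReduced (fun i => (v i : I → k)) c) :
    ∃ w : Basis (Fin h) k (degeneration V.1 A),
      ∀ i, (w i : I → k) = initialForm A c (fun i => v i) i :=
  exists_basis_coe_eq hv.initialForm (initialForm_mem hv (fun i => (v i).2) hc) fun _ hx hxc =>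
    eq_zero_of_mem_degeneration (fun _ => eq_zero_of_plucker_ne_zero hVc) hc hx hxc

theorem finrank_degeneration {V : Gr k I h} (hVc : plucker V c ≠ 0) (hc : A.Between (cols c)) :
    finrank k (degeneration V.1 A) = h := by
  obtain ⟨v, hv⟩ := exists_reduced_basis V hVc
  obtain ⟨w, -⟩ := exists_basis_degeneration hVc hc hv
  rw [finrank_eq_card_basis w, Fintype.card_fin]

theorem isPluckerVector_degeneration {V : Gr k I h} (hVc : plucker V c ≠ 0)
    (hc : A.Between (cols c)) (hd : finrank k (degeneration V.1 A) = h) :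
    IsPluckerVector (⟨degeneration V.1 A, hd⟩ : Gr k I h)
      (Set.indicator {c' | A.Between (cols c')} (plucker V)) := by
  obtain ⟨v, hv⟩ := exists_reduced_basis V hVc
  obtain ⟨w, hw⟩ := exists_basis_degeneration hVc hc hv
  obtain ⟨a, ha⟩ := exists_pluckerOfBasis_eq V v
  obtain ⟨b, hb⟩ := isPluckerVector_pluckerOfBasis (⟨degeneration V.1 A, hd⟩ : Gr k I h) w
  refine ⟨b * a, fun c' => ?_⟩
  have hminor : pluckerOfBasis w c' =
      Set.indicator {c' | A.Between (cols c')} (pluckerOfBasis v) c' := by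
    have hdet := det_of_weight_eq (Matrix.of fun i j => (v i : I → k) (c' j))
      fun i j => hv.level_le hc
    rw [← sum_cols, ← sum_cols] at hdet
    have hbetween := A.isWeight_level.sum_eq_sum_iff hc (cols_subset c')
      ((card_cols c).trans (card_cols c').symm)
    classical
    simp only [pluckerOfBasis, hw, initialForm]
    exact hdet.trans ((if_congr hbetween rfl rfl).trans
      (Set.indicator_apply {c' | A.Between (cols c')} (pluckerOfBasis v) c').symm)
  rw [hb, hminor, Units.val_mul, mul_assoc, (funext ha : pluckerOfBasis v = _)]
  exact congrArg _ (Set.indicator_const_mul _ _ _ _)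

end InitialForms

section Compatibility

variable {Δ : Type*} [DecidableEq Δ] {I J : Finset Δ} {A : Tripartition I} {B : Tripartition J}

theorem Tripartition.IsWeight.congr {a b : Δ → ℕ} {θ : ℕ} (ha : A.IsWeight a θ)
    (hab : ∀ i ∈ I, a i = b i) : A.IsWeight b θ :=
  ⟨fun i hi => hab i (A.fst_subset hi) ▸ ha.1 i hi,
    fun i hi => hab i (A.mid_subset hi) ▸ ha.2.1 i hi,
    fun i hi => hab i (A.lst_subset hi) ▸ ha.2.2 i hi⟩

/-- `A` and `B` induce the same tripartition of `I ∩ J`. -/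
def SameParts (A : Tripartition I) (B : Tripartition J) : Prop :=
  ∀ i ∈ I ∩ J, (i ∈ A.fst ↔ i ∈ B.fst) ∧ (i ∈ A.lst ↔ i ∈ B.lst)

/-- `A` and `B` arise from a common weight whose threshold for `A` is below the one for `B`: no
element of `I ∩ J` can be both at most the former and at least the latter. -/
def Above (A : Tripartition I) (B : Tripartition J) : Prop :=
  ∀ i ∈ I ∩ J, i ∈ B.fst ∨ i ∈ A.lst

theorem not_subset_imp_subset_iff :
    ((¬ A.fst ∩ J ⊆ B.fst ∩ I ∨ ¬ B.lst ∩ I ⊆ A.lst ∩ J) → J ∩ (I \ A.fst) ⊆ B.lst ∩ I) ↔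
      (∀ i ∈ I ∩ J, (i ∈ A.fst → i ∈ B.fst) ∧ (i ∈ B.lst → i ∈ A.lst)) ∨ Above B A := by
  have hA := fun i (hi : i ∈ A.fst) => A.fst_subset hi
  have hB := fun i (hi : i ∈ B.lst) => B.lst_subset hi
  rw [← not_and_or, ← or_iff_not_imp_left]
  refine or_congr ?_ ?_
  · simp only [Finset.subset_iff, Finset.mem_inter]
    exact ⟨fun h i hi => ⟨fun hf => (h.1 ⟨hf, hi.2⟩).1, fun hl => (h.2 ⟨hl, hi.1⟩).1⟩, fun h =>
      ⟨fun i hi => ⟨(h i ⟨hA i hi.1, hi.2⟩).1 hi.1, hA i hi.1⟩,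
        fun i hi => ⟨(h i ⟨hi.2, hB i hi.1⟩).2 hi.1, hB i hi.1⟩⟩⟩
  · simp only [Above, Finset.subset_iff, Finset.mem_inter, Finset.mem_sdiff]
    exact ⟨fun h i hi => or_iff_not_imp_left.2 fun hf => (h ⟨hi.1, hi.2, hf⟩).1,
      fun h i hi => ⟨(h i ⟨hi.1, hi.2.1⟩).resolve_left hi.2.2, hi.2.1⟩⟩

theorem Above.mem_fst_and_mem_lst (hAB : Above A B) :
    ∀ i ∈ I ∩ J, (i ∈ A.fst → i ∈ B.fst) ∧ (i ∈ B.lst → i ∈ A.lst) := fun i hi =>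
  ⟨fun hf => (hAB i hi).resolve_right (A.notMem_lst_of_mem_fst hf),
    fun hl => (hAB i hi).resolve_left fun hf => B.notMem_lst_of_mem_fst hf hl⟩

theorem compatible_iff : Compatible A B ↔ SameParts A B ∨ Above A B ∨ Above B A := by
  rw [Compatible, not_subset_imp_subset_iff, not_subset_imp_subset_iff]
  constructor
  · rintro ⟨hA | hA, hB⟩
    · refine hB.imp (fun hB i hi => ?_) Or.inl
      have hB := hB i (Finset.inter_comm I J ▸ hi)
      exact ⟨⟨(hA i hi).1, hB.1⟩, ⟨hB.2, (hA i hi).2⟩⟩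
    · exact Or.inr (Or.inr hA)
  · rintro (h | h | h)
    · refine ⟨Or.inl fun i hi => ⟨(h i hi).1.1, (h i hi).2.2⟩, Or.inl fun i hi => ?_⟩
      rw [Finset.inter_comm] at hi
      exact ⟨(h i hi).1.2, (h i hi).2.1⟩
    · exact ⟨Or.inl h.mem_fst_and_mem_lst, Or.inr h⟩
    · exact ⟨Or.inr h, Or.inl h.mem_fst_and_mem_lst⟩

theorem Compatible.symm (hAB : Compatible A B) : Compatible B A :=
  ⟨hAB.2, hAB.1⟩

theorem SameParts.exists_weight (hAB : SameParts A B) :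
    ∃ (n : Δ → ℕ) (θ θ' : ℕ), A.IsWeight n θ ∧ B.IsWeight n θ' := by
  refine ⟨fun i => if i ∈ I then A.level i else B.level i, 1, 1,
    A.isWeight_level.congr fun i hi => (if_pos hi).symm, B.isWeight_level.congr fun i hJ => ?_⟩
  split_ifs with hI
  · have hi := hAB i (Finset.mem_inter.2 ⟨hI, hJ⟩)
    simp only [Tripartition.level, hi.1, hi.2]
  · rfl

theorem Above.exists_weight (hAB : Above A B) :
    ∃ (n : Δ → ℕ) (θ θ' : ℕ), A.IsWeight n θ ∧ B.IsWeight n θ' := by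
  have hB : ∀ i ∈ J, i ∉ B.fst → i ∉ I \ A.lst := fun i hJ hi hIA =>
    (hAB i (Finset.mem_inter.2 ⟨(Finset.mem_sdiff.1 hIA).1, hJ⟩)).elim hi (Finset.mem_sdiff.1 hIA).2
  have hB' : ∀ i ∈ J, i ∉ B.fst →
      (if i ∈ I \ A.lst then A.level i else B.level i + 2) = B.level i + 2 := fun i hJ hi =>
    if_neg (hB i hJ hi)
  refine ⟨fun i => if i ∈ I \ A.lst then A.level i else B.level i + 2, 1, 3,
    ⟨fun i hi => ?_, fun i hi => ?_, fun i hi => ?_⟩,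
    ⟨fun i hi => ?_, fun i hi => ?_, fun i hi => ?_⟩⟩
  · grind [A.isWeight_level.1 i hi, A.fst_subset hi, A.notMem_lst_of_mem_fst hi]
  · grind [A.isWeight_level.2.1 i hi, A.mid_subset hi, (A.mem_mid_iff (A.mid_subset hi)).1 hi]
  · grind
  · have hA : i ∈ I \ A.lst → A.level i ≤ 1 := fun hA =>
      A.isWeight_level.le (Finset.mem_sdiff.1 hA).1 (Finset.mem_sdiff.1 hA).2
    grind [B.isWeight_level.1 i hi]
  · have hf := ((B.mem_mid_iff (B.mid_subset hi)).1 hi).1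
    exact (hB' i (B.mid_subset hi) hf).trans (congrArg (· + 2) (B.isWeight_level.2.1 i hi))
  · have hf : i ∉ B.fst := Finset.disjoint_right.1 B.disjoint_fst_lst hi
    exact (Nat.add_lt_add_right (B.isWeight_level.2.2 i hi) 2).trans_eq
      (hB' i (B.lst_subset hi) hf).symm

theorem Compatible.exists_weight (hAB : Compatible A B) :
    ∃ (n : Δ → ℕ) (θ θ' : ℕ), A.IsWeight n θ ∧ B.IsWeight n θ' := by
  rcases compatible_iff.1 hAB with h | h | h
  · exact h.exists_weight
  · exact h.exists_weight
  · obtain ⟨n, θ, θ', hB, hA⟩ := h.exists_weight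
    exact ⟨n, θ', θ, hA, hB⟩

/-- The tripartition obtained from `A` by keeping only the elements of `E` in the first part and
moving its other elements to the middle part. -/
def Tripartition.shrinkFst (A : Tripartition I) (E : Finset Δ) (hE : E ⊆ A.fst) :
    Tripartition I where
  fst := E
  mid := A.mid ∪ A.fst \ E
  lst := A.lst
  disjoint_fst_mid := Finset.disjoint_union_right.2
    ⟨A.disjoint_fst_mid.mono_left hE, Finset.disjoint_sdiff⟩
  disjoint_fst_lst := A.disjoint_fst_lst.mono_left hE
  disjoint_mid_lst := Finset.disjoint_union_left.2
    ⟨A.disjoint_mid_lst, A.disjoint_fst_lst.mono_left Finset.sdiff_subset⟩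
  union_eq := by
    refine Eq.trans ?_ A.union_eq
    rw [Finset.union_comm A.mid, ← Finset.union_assoc, Finset.union_sdiff_of_subset hE]

theorem Compatible.exists_fst_ssubset (hAB : Compatible A B) (hmid : A.mid = ∅)
    (hfst : A.fst.Nonempty) :
    ∃ A' : Tripartition I, A'.fst ⊂ A.fst ∧ A'.lst = A.lst ∧ Compatible A' B := by
  suffices h : ∃ (E : Finset Δ) (hE : E ⊂ A.fst), Compatible (A.shrinkFst E hE.1) B by
    obtain ⟨E, hE, hcomp⟩ := h
    exact ⟨A.shrinkFst E hE.1, hE, rfl, hcomp⟩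
  have hA : ∀ i ∈ I, i ∉ A.fst → i ∈ A.lst := fun i hi hif => by
    simpa [hif, hmid] using A.mem_cases hi
  simp only [compatible_iff] at hAB ⊢
  by_cases hab : Above A B
  · obtain ⟨i, hi⟩ := hfst
    exact ⟨A.fst.erase i, Finset.erase_ssubset hi, Or.inr (Or.inl hab)⟩
  have hba : Above B A := by
    refine (hAB.resolve_left fun hsame => hab fun i hi => ?_).resolve_left hab
    by_cases hif : i ∈ A.fst
    · exact Or.inl ((hsame i hi).1.1 hif)
    · exact Or.inr (hA i (Finset.mem_inter.1 hi).1 hif)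
  by_cases hfree : ∃ i ∈ A.fst, i ∈ J → i ∈ B.lst
  · obtain ⟨i, hi, hiJ⟩ := hfree
    refine ⟨A.fst.erase i, Finset.erase_ssubset hi, Or.inr (Or.inr fun j hj => ?_)⟩
    by_cases hji : j = i
    · exact Or.inr (hji ▸ hiJ (hji ▸ (Finset.mem_inter.1 hj).1))
    · exact (hba j hj).imp_left fun hj' => Finset.mem_erase.2 ⟨hji, hj'⟩
  · push Not at hfree
    have hne : A.fst ∩ B.fst ≠ A.fst := fun heq => hab fun i hi => by
      by_cases hif : i ∈ A.fst
      · exact Or.inl (Finset.inter_eq_left.1 heq hif)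
      · exact Or.inr (hA i (Finset.mem_inter.1 hi).1 hif)
    refine ⟨A.fst ∩ B.fst, Finset.inter_subset_left.ssubset_of_ne hne, Or.inl fun i hi => ?_⟩
    have hba' := hba i (Finset.inter_comm I J ▸ hi)
    constructor
    · refine ⟨fun h => (Finset.mem_inter.1 h).2, fun h => Finset.mem_inter.2
        ⟨hba'.resolve_right (B.notMem_lst_of_mem_fst h), h⟩⟩
    · refine ⟨fun h => hba'.resolve_left (Finset.disjoint_right.1 A.disjoint_fst_lst h),
        fun h => hA i (Finset.mem_inter.1 hi).1 fun hif => (hfree i hif).2 h⟩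

end Compatibility

section Closure

variable {k : Type*} [Field k]

theorem eval_of_isWeightedHomogeneous {σ : Type*} {w : σ → ℕ × ℕ} {f : MvPolynomial σ k} {d e : ℕ}
    (hf : f.IsWeightedHomogeneous w (d, e)) (a b : k) (x : σ → k) :
    MvPolynomial.eval (fun i => a ^ (w i).1 * b ^ (w i).2 * x i) f =
      a ^ d * b ^ e * MvPolynomial.eval x f := by
  rw [MvPolynomial.eval_eq, MvPolynomial.eval_eq, Finset.mul_sum]
  refine Finset.sum_congr rfl fun m hm => ?_
  have hweight := hf (MvPolynomial.mem_support_iff.1 hm)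
  rw [Finsupp.weight_apply, Finsupp.sum] at hweight
  have hd := congrArg Prod.fst hweight
  have he := congrArg Prod.snd hweight
  simp only [Prod.fst_sum, Prod.snd_sum, Prod.smul_fst, Prod.smul_snd, smul_eq_mul] at hd he
  simp only [mul_pow, Finset.prod_mul_distrib, ← pow_mul, Finset.prod_pow_eq_pow_sum,
    mul_comm (w _).1, mul_comm (w _).2, hd, he]
  ring

variable {ι κ : Type*} [Finite ι] [Finite κ] {h₁ h₂ : ℕ}

theorem IsBihomogeneous.eval_eq_zero_iff {f : MvPolynomial ((Fin h₁ ↪ ι) ⊕ (Fin h₂ ↪ κ)) k}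
    (hf : IsBihomogeneous k ι κ h₁ h₂ f) {P : Gr k ι h₁ × Gr k κ h₂} {x : (Fin h₁ ↪ ι) → k}
    {y : (Fin h₂ ↪ κ) → k} (hx : IsPluckerVector P.1 x) (hy : IsPluckerVector P.2 y) :
    MvPolynomial.eval (Sum.elim (plucker P.1) (plucker P.2)) f = 0 ↔
      MvPolynomial.eval (Sum.elim x y) f = 0 := by
  obtain ⟨d, e, hf⟩ := hf
  obtain ⟨a, ha⟩ := hx
  obtain ⟨b, hb⟩ := hy
  have hscale := eval_of_isWeightedHomogeneous hf a b (Sum.elim x y)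
  have hcoord : Sum.elim (plucker P.1) (plucker P.2) = fun i =>
      (a : k) ^ (Sum.elim (fun _ => ((1, 0) : ℕ × ℕ)) (fun _ => ((0, 1) : ℕ × ℕ)) i).1 *
      (b : k) ^ (Sum.elim (fun _ => ((1, 0) : ℕ × ℕ)) (fun _ => ((0, 1) : ℕ × ℕ)) i).2 *
      Sum.elim x y i := by
    ext (i | i) <;> simp [ha, hb]
  rw [hcoord, hscale]
  simp

theorem mem_closure_zariski_iff {S : Set (Gr k ι h₁ × Gr k κ h₂)} {P : Gr k ι h₁ × Gr k κ h₂} :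
    P ∈ @closure _ (zariski k ι κ h₁ h₂) S ↔
      ∀ f, IsBihomogeneous k ι κ h₁ h₂ f →
        (∀ Q ∈ S, MvPolynomial.eval (Sum.elim (plucker Q.1) (plucker Q.2)) f = 0) →
        MvPolynomial.eval (Sum.elim (plucker P.1) (plucker P.2)) f = 0 := by
  let _ := zariski k ι κ h₁ h₂
  have hbasis := TopologicalSpace.isTopologicalBasis_of_subbasis_of_inter
    (t := zariski k ι κ h₁ h₂) rfl (by
      rintro _ ⟨f, ⟨d, e, hf⟩, rfl⟩ _ ⟨g, ⟨d', e', hg⟩, rfl⟩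
      refine ⟨f * g, ⟨d + d', e + e', hf.mul hg⟩, ?_⟩
      ext P
      simp)
  rw [hbasis.mem_closure_iff]
  constructor
  · intro h f hf hS
    by_contra hP
    obtain ⟨Q, hQ, hQS⟩ := h _ (Or.inr ⟨f, hf, rfl⟩) hP
    exact hQ (hS Q hQS)
  · intro h U hU hP
    by_contra hempty
    rcases hU with rfl | ⟨f, hf, rfl⟩
    · have hone := h 1 ⟨0, 0, MvPolynomial.isWeightedHomogeneous_one k _⟩ fun Q hQ =>
        (hempty ⟨Q, trivial, hQ⟩).elim
      simp at hone
    · exact hP (h f hf fun Q hQ => by_contra fun hne => hempty ⟨Q, hne, hQ⟩)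

open Polynomial

theorem eval_zero_eq_zero_of_forall_units [Infinite k] {F : k[X]}
    (hF : ∀ z : kˣ, F.eval (z : k) = 0) : F.eval 0 = 0 := by
  have hzero : F = 0 := F.eq_zero_of_infinite_isRoot
    ((Set.finite_singleton (0 : k)).infinite_compl.mono fun z hz => hF (Units.mk0 z hz))
  rw [hzero, eval_zero]

theorem mem_closure_zariski_of_curve [Infinite k] {S : Set (Gr k ι h₁ × Gr k κ h₂)}
    {P : Gr k ι h₁ × Gr k κ h₂} {p : (Fin h₁ ↪ ι) → k[X]} {q : (Fin h₂ ↪ κ) → k[X]}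
    (hp : IsPluckerVector P.1 fun c => (p c).eval 0)
    (hq : IsPluckerVector P.2 fun c => (q c).eval 0)
    (hS : ∀ z : kˣ, ∃ Q ∈ S, IsPluckerVector Q.1 (fun c => (p c).eval (z : k)) ∧
      IsPluckerVector Q.2 (fun c => (q c).eval (z : k))) :
    P ∈ @closure _ (zariski k ι κ h₁ h₂) S := by
  rw [mem_closure_zariski_iff]
  intro f hf hfS
  have heval : ∀ z, (MvPolynomial.aeval (Sum.elim p q) f).eval z =
      MvPolynomial.eval (Sum.elim (fun c => (p c).eval z) (fun c => (q c).eval z)) f := by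
    intro z
    rw [← Polynomial.coe_aeval_eq_eval, ← AlgHom.comp_apply, MvPolynomial.comp_aeval,
      ← MvPolynomial.coe_aeval_eq_eval]
    refine congrArg (fun g => MvPolynomial.aeval g f) (funext ?_)
    rintro (c | c) <;> rfl
  rw [hf.eval_eq_zero_iff hp hq, ← heval]
  refine eval_zero_eq_zero_of_forall_units fun z => ?_
  obtain ⟨Q, hQS, hQp, hQq⟩ := hS z
  rw [heval, ← hf.eval_eq_zero_iff hQp hQq]
  exact hfS Q hQS

end Closure

section Degeneration

open Polynomial

variable {k : Type*} [Field k] {Δ : Type*} {I J : Finset Δ} {h₁ h₂ : ℕ}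

theorem torusChar_pow (z : kˣ) (a : Δ → ℕ) (c : Fin h₁ ↪ I) :
    torusChar (fun i : I => z ^ a i) c = z ^ ∑ i ∈ cols c, a i := by
  rw [torusChar, Finset.prod_pow_eq_pow_sum, sum_cols]

theorem pow_mem_torus {lam tau : ℕ} (z : kˣ) (n : Δ → ℕ) :
    ((fun i : I => z ^ (lam * n i), fun i : J => z ^ (tau * n i)) : (I → kˣ) × (J → kˣ)) ∈
      torus k I J lam tau := by
  intro i j _ _ _ _
  simp only [← pow_mul, ← pow_add]
  congr 1
  ring

variable [DecidableEq Δ] {A : Tripartition I} {B : Tripartition J}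

/-- The Plücker vectors of `s z ^ a · V`, divided by the lowest power of `z` occurring in them,
form a polynomial curve that extends over `z = 0`. -/
theorem exists_curve_to_degeneration {V : Gr k I h₁} {c : Fin h₁ ↪ I} (hVc : plucker V c ≠ 0)
    (hc : A.Between (cols c)) (hd : finrank k (degeneration V.1 A) = h₁) {a : Δ → ℕ} {θ : ℕ}
    (ha : A.IsWeight a θ) (s : I → kˣ) :
    ∃ p : (Fin h₁ ↪ I) → k[X],
      IsPluckerVector (act s ⟨degeneration V.1 A, hd⟩) (fun c => (p c).eval 0) ∧
      ∀ z : kˣ, IsPluckerVector (act (s * fun i : I => z ^ a i) V) fun c => (p c).eval (z : k) := by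
  classical
  set ρ := ∑ i ∈ cols c, a i
  refine ⟨fun c' => C (torusChar s c' * plucker V c') * X ^ (∑ i ∈ cols c', a i - ρ), ?_, ?_⟩
  · convert (isPluckerVector_degeneration hVc hc hd).act s using 2 with c'
    have hcard := (card_cols c).trans (card_cols c').symm
    have hiff : ∑ i ∈ cols c', a i - ρ = 0 ↔ A.Between (cols c') := by
      rw [← ha.sum_eq_sum_iff hc (cols_subset c') hcard, Nat.sub_eq_zero_iff_le]
      exact ⟨(ha.sum_le_sum hc (cols_subset c') hcard).antisymm, ge_of_eq⟩
    rw [eval_mul, eval_C, eval_pow, eval_X, zero_pow_eq, mul_assoc, if_congr hiff rfl rfl,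
      mul_ite, mul_one, mul_zero, Set.indicator_apply]
    rfl
  · intro z
    convert ((isPluckerVector_plucker V).act _).units_mul (z ^ ρ)⁻¹ using 2 with c'
    have hle := ha.sum_le_sum hc (cols_subset c') ((card_cols c).trans (card_cols c').symm)
    have hpow : (z : k) ^ (∑ i ∈ cols c', a i) = z ^ ρ * z ^ (∑ i ∈ cols c', a i - ρ) := by
      rw [← pow_add, Nat.add_sub_cancel' hle]
    rw [torusChar_mul, torusChar_pow]
    simp only [eval_mul, eval_C, eval_pow, eval_X, Units.val_mul, Units.val_pow_eq_pow_val, hpow,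
      Units.val_inv_eq_inv_val]
    field_simp

theorem degeneration_mem_closure [Infinite k] {V : Gr k I h₁} {W : Gr k J h₂} {lam tau : ℕ}
    (hlam : 0 < lam) (htau : 0 < tau) (hAB : Compatible A B)
    {c : Fin h₁ ↪ I} (hVc : plucker V c ≠ 0) (hc : A.Between (cols c))
    {c' : Fin h₂ ↪ J} (hWc' : plucker W c' ≠ 0) (hc' : B.Between (cols c'))
    (hV : finrank k (degeneration V.1 A) = h₁) (hW : finrank k (degeneration W.1 B) = h₂)
    {p : (I → kˣ) × (J → kˣ)} (hp : p ∈ torus k I J lam tau) :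
    (act p.1 ⟨degeneration V.1 A, hV⟩, act p.2 ⟨degeneration W.1 B, hW⟩) ∈
      @closure _ (zariski k I J h₁ h₂) (orbit (torus k I J lam tau) (V, W)) := by
  obtain ⟨n, θ, θ', hnA, hnB⟩ := hAB.exists_weight
  obtain ⟨x, hx₀, hx⟩ := exists_curve_to_degeneration hVc hc hV (hnA.const_mul hlam) p.1
  obtain ⟨y, hy₀, hy⟩ := exists_curve_to_degeneration hWc' hc' hW (hnB.const_mul htau) p.2
  exact mem_closure_zariski_of_curve hx₀ hy₀ fun z =>
    ⟨_, ⟨_, mul_mem hp (pow_mem_torus z n), rfl⟩, hx z, hy z⟩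

end Degeneration

section Exchange

variable {Δ : Type*} [DecidableEq Δ] {S T : Finset Δ} {i j l : Δ}

/-- The set `S` with its element `i` replaced by `j`, the basic move between sets of columns. -/
def exchange (S : Finset Δ) (i j : Δ) : Finset Δ :=
  insert j (S.erase i)

theorem mem_exchange {x : Δ} : x ∈ exchange S i j ↔ x = j ∨ x ≠ i ∧ x ∈ S := by
  rw [exchange, Finset.mem_insert, Finset.mem_erase]

theorem notMem_exchange (hi : i ∈ S) (hj : j ∉ S) : i ∉ exchange S i j := by
  rw [mem_exchange]
  rintro (rfl | h)
  exacts [hj hi, h.1 rfl]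

theorem card_exchange (hi : i ∈ S) (hj : j ∉ S) : (exchange S i j).card = S.card := by
  rw [exchange, Finset.card_insert_of_notMem fun h => hj (Finset.mem_of_mem_erase h),
    Finset.card_erase_add_one hi]

theorem exchange_subset {I : Finset Δ} (hS : S ⊆ I) (hj : j ∈ I) : exchange S i j ⊆ I :=
  Finset.insert_subset hj ((Finset.erase_subset _ _).trans hS)

theorem prod_exchange_mul {M : Type*} [CommMonoid M] (hi : i ∈ S) (hj : j ∉ S) (f : Δ → M) :
    (∏ x ∈ exchange S i j, f x) * f i = (∏ x ∈ S, f x) * f j := by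
  rw [exchange, Finset.prod_insert fun h => hj (Finset.mem_of_mem_erase h), mul_assoc, mul_comm,
    Finset.prod_erase_mul _ _ hi]

theorem exchange_exchange (hj : j ∉ S) : exchange (exchange S i j) j l = exchange S i l := by
  ext x
  simp only [mem_exchange]
  by_cases hx : x = j
  · simp [hx, hj]
  · simp [hx]

theorem exchange_exchange_self (hi : i ∈ S) (hj : j ∉ S) : exchange (exchange S i j) j i = S := by
  rw [exchange_exchange hj, exchange, Finset.insert_erase hi]

theorem exchange_exchange_comm (hi : i ∈ S) (hl : l ∈ S) (hil : i ≠ l) (hj : j ∉ S) :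
    exchange (exchange S l j) i l = exchange S i j := by
  ext x
  simp only [mem_exchange]
  by_cases hxl : x = l
  · simp [hxl, hl, hil.symm]
  · by_cases hxj : x = j
    · simpa [hxj] using Or.inr (ne_of_mem_of_not_mem hi hj).symm
    · simp [hxl, hxj]

theorem exchange_sdiff (hj : j ∈ T) : exchange S i j \ T = (S \ T).erase i := by
  rw [exchange, Finset.insert_sdiff_of_mem _ hj, Finset.erase_sdiff_comm]

theorem exchange_induction {p : Finset Δ → Prop} (hcard : S.card = T.card) (hS : p S)
    (hstep : ∀ S, p S → ∀ i ∈ S \ T, ∀ j ∈ T \ S, p (exchange S i j)) : p T := by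
  induction hn : (S \ T).card generalizing S with
  | zero =>
    rw [Finset.card_eq_zero, Finset.sdiff_eq_empty_iff_subset] at hn
    rwa [← Finset.eq_of_subset_of_card_le hn hcard.ge]
  | succ n ih =>
    obtain ⟨i, hi⟩ : (S \ T).Nonempty := Finset.card_pos.1 (hn ▸ n.succ_pos)
    obtain ⟨j, hj⟩ : (T \ S).Nonempty :=
      Finset.card_pos.1 (Finset.card_sdiff_comm hcard ▸ hn ▸ n.succ_pos)
    have hiS := (Finset.mem_sdiff.1 hi).1
    have hjT := Finset.mem_sdiff.1 hj
    refine ih ((card_exchange hiS hjT.2).trans hcard) (hstep S hS i hi j hj) ?_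
    rw [exchange_sdiff hjT.1, Finset.card_erase_of_mem hi, hn, Nat.add_sub_cancel]

end Exchange

section ExchangeRelations

variable {Δ : Type*} [DecidableEq Δ] {G₀ : Type*} [CommGroupWithZero G₀] {I J : Finset Δ}
  {h : ℕ} {U : Finset Δ → G₀} {S T : Finset Δ} {i j : Δ}

/-- `U` is a function on the `h`-element subsets of `I`, not identically zero and extended by zero
to all sets, that satisfies the two-term exchange relations of a family of monomials. -/
structure ExchangeRelations (I : Finset Δ) (h : ℕ) (U : Finset Δ → G₀) : Prop where
  subset_of_ne_zero : ∀ {S}, U S ≠ 0 → S ⊆ I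
  card_of_ne_zero : ∀ {S}, U S ≠ 0 → S.card = h
  exists_ne_zero : ∃ S, U S ≠ 0
  mul_eq : ∀ {S T i j}, U S ≠ 0 → U T ≠ 0 → i ∈ S → i ∉ T → j ∈ T → j ∉ S →
    U S * U T = U (exchange S i j) * U (exchange T j i)

namespace ExchangeRelations

theorem exchange_ne_zero (hU : ExchangeRelations I h U) (hS : U S ≠ 0) (hT : U T ≠ 0)
    (hiS : i ∈ S) (hiT : i ∉ T) (hjT : j ∈ T) (hjS : j ∉ S) : U (exchange S i j) ≠ 0 :=
  left_ne_zero_of_mul (hU.mul_eq hS hT hiS hiT hjT hjS ▸ mul_ne_zero hS hT)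

theorem exists_mem_notMem (hU : ExchangeRelations I h U) (hS : U S ≠ 0) (hT : U T ≠ 0)
    (hi : i ∈ S) (hj : j ∉ T) (hij : i ≠ j) : ∃ R, U R ≠ 0 ∧ i ∈ R ∧ j ∉ R := by
  by_cases hjS : j ∈ S
  · by_cases hiT : i ∈ T
    · exact ⟨T, hT, hiT, hj⟩
    · have hcard := (hU.card_of_ne_zero hT).trans (hU.card_of_ne_zero hS).symm
      obtain ⟨l, hl⟩ : (T \ S).Nonempty := Finset.card_pos.1 <|
        Finset.card_sdiff_comm hcard ▸ Finset.card_pos.2 ⟨i, Finset.mem_sdiff.2 ⟨hi, hiT⟩⟩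
      obtain ⟨hlT, hlS⟩ := Finset.mem_sdiff.1 hl
      exact ⟨exchange S j l, hU.exchange_ne_zero hS hT hjS hj hlT hlS,
        mem_exchange.2 (Or.inr ⟨hij, hi⟩), notMem_exchange hjS hlS⟩
  · exact ⟨S, hS, hi, hjS⟩

theorem ne_zero_of_forall (hU : ExchangeRelations I h U) (hT : T.card = h)
    (hmem : ∀ i ∈ T, ∃ S, U S ≠ 0 ∧ i ∈ S) (hnotMem : ∀ i ∈ I, i ∉ T → ∃ S, U S ≠ 0 ∧ i ∉ S) :
    U T ≠ 0 := by
  obtain ⟨S, hS⟩ := hU.exists_ne_zero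
  refine exchange_induction (p := fun S => U S ≠ 0) ((hU.card_of_ne_zero hS).trans hT.symm) hS
    fun S hS i hi j hj => ?_
  obtain ⟨hiS, hiT⟩ := Finset.mem_sdiff.1 hi
  obtain ⟨hjT, hjS⟩ := Finset.mem_sdiff.1 hj
  obtain ⟨S₁, hS₁, hjS₁⟩ := hmem j hjT
  obtain ⟨S₂, hS₂, hiS₂⟩ := hnotMem i (hU.subset_of_ne_zero hS hiS) hiT
  obtain ⟨R, hR, hjR, hiR⟩ := hU.exists_mem_notMem hS₁ hS₂ hjS₁ hiS₂
    (ne_of_mem_of_not_mem hiS hjS).symm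
  exact hU.exchange_ne_zero hS hR hiS hiR hjR hjS

open scoped Classical in
/-- The tripartition of `I` read off the support of `U`: the elements lying in all sets of the
support, in some but not all of them, and in none of them. -/
def tripartition (hU : ExchangeRelations I h U) : Tripartition I where
  fst := I.filter fun i => ∀ S, U S ≠ 0 → i ∈ S
  mid := I.filter fun i => (∃ S, U S ≠ 0 ∧ i ∈ S) ∧ ∃ S, U S ≠ 0 ∧ i ∉ S
  lst := I.filter fun i => ∀ S, U S ≠ 0 → i ∉ S
  disjoint_fst_mid := Finset.disjoint_filter.2 fun i _ hi ⟨_, S, hS, hiS⟩ => hiS (hi S hS)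
  disjoint_fst_lst := Finset.disjoint_filter.2 fun i _ hi hi' =>
    hU.exists_ne_zero.elim fun S hS => hi' S hS (hi S hS)
  disjoint_mid_lst := Finset.disjoint_filter.2 fun i _ ⟨⟨S, hS, hiS⟩, _⟩ hi => hi S hS hiS
  union_eq := by
    ext i
    simp only [Finset.mem_union, Finset.mem_filter]
    grind

variable (hU : ExchangeRelations I h U)

theorem mem_fst_iff (hi : i ∈ I) : i ∈ hU.tripartition.fst ↔ ∀ S, U S ≠ 0 → i ∈ S := by
  simp [tripartition, hi]

theorem mem_lst_iff (hi : i ∈ I) : i ∈ hU.tripartition.lst ↔ ∀ S, U S ≠ 0 → i ∉ S := by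
  simp [tripartition, hi]

theorem mem_mid_iff : i ∈ hU.tripartition.mid ↔
    (∃ S, U S ≠ 0 ∧ i ∈ S) ∧ ∃ S, U S ≠ 0 ∧ i ∉ S := by
  simp only [tripartition, Finset.mem_filter, and_iff_right_iff_imp]
  exact fun ⟨⟨S, hS, hi⟩, _⟩ => hU.subset_of_ne_zero hS hi

theorem exists_separating (hi : i ∈ I) (hj : j ∈ I) (hij : i ≠ j)
    (hil : i ∉ hU.tripartition.lst) (hjf : j ∉ hU.tripartition.fst) :
    ∃ S, U S ≠ 0 ∧ i ∈ S ∧ j ∉ S := by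
  rw [hU.mem_lst_iff hi] at hil
  rw [hU.mem_fst_iff hj] at hjf
  push Not at hil hjf
  obtain ⟨S, hS, hiS⟩ := hil
  obtain ⟨T, hT, hjT⟩ := hjf
  exact hU.exists_mem_notMem hS hT hiS hjT hij

end ExchangeRelations

/-- The support of `U` consists of the `h`-element sets between the first part of `A` and the
complement of its last part. -/
def HasSupport (U : Finset Δ → G₀) (h : ℕ) (A : Tripartition I) : Prop :=
  ∀ S, U S ≠ 0 ↔ A.Between S ∧ S.card = h

variable (hU : ExchangeRelations I h U)
include hU

namespace ExchangeRelations

theorem hasSupport_tripartition : HasSupport U h hU.tripartition := by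
  intro S
  constructor
  · intro hS
    have hSI := hU.subset_of_ne_zero hS
    refine ⟨⟨fun i hi => ?_, fun i hi => Finset.mem_sdiff.2 ⟨hSI hi, fun hil => ?_⟩⟩,
      hU.card_of_ne_zero hS⟩
    · exact (hU.mem_fst_iff (hU.tripartition.fst_subset hi)).1 hi S hS
    · exact (hU.mem_lst_iff (hSI hi)).1 hil S hS hi
  · rintro ⟨⟨hfst, hlst⟩, hcard⟩
    refine hU.ne_zero_of_forall hcard (fun i hi => ?_) fun i hiI hi => ?_ <;> by_contra! hall
    · obtain ⟨hiI, hil⟩ := Finset.mem_sdiff.1 (hlst hi)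
      exact hil ((hU.mem_lst_iff hiI).2 hall)
    · exact hi (hfst ((hU.mem_fst_iff hiI).2 hall))

theorem tripartition_mid_eq_empty (hcard : hU.tripartition.fst.card = h) :
    hU.tripartition.mid = ∅ := by
  have heq : ∀ S, U S ≠ 0 → S = hU.tripartition.fst := fun S hS =>
    (Finset.eq_of_subset_of_card_le ((hU.hasSupport_tripartition S).1 hS).1.1
      (hcard.symm ▸ (hU.card_of_ne_zero hS).le)).symm
  refine Finset.eq_empty_of_forall_notMem fun i hi => ?_
  obtain ⟨⟨S, hS, hiS⟩, T, hT, hiT⟩ := hU.mem_mid_iff.1 hi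
  exact hiT (heq T hT ▸ heq S hS ▸ hiS)

end ExchangeRelations

/-- If the support is a single set, the bounds fail for its tripartition, but there is some freedom
in the choice of the first part. -/
theorem ExchangeRelations.exists_bounds_compatible (hpos : 0 < h) {B : Tripartition J}
    (hAB : Compatible hU.tripartition B) :
    ∃ A : Tripartition I, A.Bounds h ∧ HasSupport U h A ∧ Compatible A B := by
  obtain ⟨S₀, hS₀⟩ := hU.exists_ne_zero
  have hsupp := hU.hasSupport_tripartition
  obtain ⟨⟨hfst, hlst⟩, hcard⟩ := (hsupp S₀).1 hS₀
  have hle := (Finset.card_le_card hfst).trans_eq hcard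
  have hge := hcard.ge.trans (Finset.card_le_card hlst)
  rcases hle.lt_or_eq with hlt | heq
  · exact ⟨_, ⟨hlt, hge⟩, hsupp, hAB⟩
  have hmid := hU.tripartition_mid_eq_empty heq
  obtain ⟨A, hA, hAlst, hcomp⟩ :=
    hAB.exists_fst_ssubset hmid (Finset.card_pos.1 (hpos.trans_eq heq.symm))
  have hcompl : I \ hU.tripartition.lst ⊆ hU.tripartition.fst := fun i hi => by
    obtain ⟨hiI, hil⟩ := Finset.mem_sdiff.1 hi
    simpa [hmid, hil] using hU.tripartition.mem_cases hiI
  refine ⟨A, ⟨(Finset.card_lt_card hA).trans_eq heq, hAlst ▸ hge⟩,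
    fun S => (hsupp S).trans ?_, hcomp⟩
  refine and_congr_left fun hS => ⟨fun hb => ⟨hA.1.trans hb.1, hAlst ▸ hb.2⟩, fun hb => ?_⟩
  have hSlst := hAlst ▸ hb.2
  have hSfst := Finset.eq_of_subset_of_card_le (hSlst.trans hcompl) (heq.trans hS.symm).le
  exact ⟨hSfst.ge, hSlst⟩

end ExchangeRelations

section Scaling

variable {Δ : Type*} [DecidableEq Δ] {G₀ : Type*} [CommGroupWithZero G₀] {I : Finset Δ}
  {h : ℕ} {U : Finset Δ → G₀} {S : Finset Δ} {i j l : Δ}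

/-- `r i j` is the factor by which `U` changes when `i` is exchanged for `j`, for all sets of the
support and all elements `i`, `j` of the middle part. -/
def IsExchangeRatio (A : Tripartition I) (U : Finset Δ → G₀) (r : Δ → Δ → G₀ˣ) : Prop :=
  ∀ ⦃i⦄, i ∈ A.mid → ∀ ⦃j⦄, j ∈ A.mid → ∀ ⦃S⦄, U S ≠ 0 → i ∈ S → j ∉ S →
    U (exchange S i j) = r i j * U S

/-- The ratios of exchange of `U` within the middle part are `s j / s i`, as for a multiple of
the monomial `∏ i ∈ S, s i`. -/
def IsExchangeScaling (A : Tripartition I) (U : Finset Δ → G₀) (s : Δ → G₀ˣ) : Prop :=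
  ∀ ⦃i⦄, i ∈ A.mid → ∀ ⦃j⦄, j ∈ A.mid → ∀ ⦃S⦄, U S ≠ 0 → i ∈ S → j ∉ S →
    U (exchange S i j) * s i = U S * s j

theorem IsExchangeScaling.congr {A : Tripartition I} {s s' : Δ → G₀ˣ}
    (hs : IsExchangeScaling A U s) (heq : Set.EqOn s' s A.mid) : IsExchangeScaling A U s' :=
  fun _ hi _ hj _ hS hiS hjS => by rw [heq hi, heq hj, hs hi hj hS hiS hjS]

variable (hU : ExchangeRelations I h U)
include hU

namespace ExchangeRelations

theorem exists_separating_of_mem_mid (hi : i ∈ hU.tripartition.mid)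
    (hj : j ∈ hU.tripartition.mid) (hij : i ≠ j) : ∃ S, U S ≠ 0 ∧ i ∈ S ∧ j ∉ S := by
  obtain ⟨⟨S, hS, hiS⟩, -⟩ := hU.mem_mid_iff.1 hi
  obtain ⟨-, T, hT, hjT⟩ := hU.mem_mid_iff.1 hj
  exact hU.exists_mem_notMem hS hT hiS hjT hij

theorem exists_isExchangeRatio : ∃ r, IsExchangeRatio hU.tripartition U r := by
  suffices hr : ∀ i j, ∃ r : G₀ˣ, i ∈ hU.tripartition.mid → j ∈ hU.tripartition.mid →
      ∀ S, U S ≠ 0 → i ∈ S → j ∉ S → U (exchange S i j) = r * U S by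
    choose r hr using hr
    exact ⟨r, fun i hi j hj S => hr i j hi hj S⟩
  intro i j
  by_cases hij : i ∈ hU.tripartition.mid ∧ j ∈ hU.tripartition.mid ∧ j ≠ i
  · obtain ⟨hi, hj, hji⟩ := hij
    obtain ⟨S, hS, hiS, hjS⟩ := hU.exists_separating_of_mem_mid hi hj hji.symm
    obtain ⟨T, hT, hjT, hiT⟩ := hU.exists_separating_of_mem_mid hj hi hji
    have hne := hU.exchange_ne_zero hT hS hjT hjS hiS hiT
    refine ⟨Units.mk0 _ (div_ne_zero hT hne), fun _ _ S' hS' hiS' hjS' => ?_⟩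
    rw [Units.val_mk0, div_mul_eq_mul_div, eq_div_iff hne, ← hU.mul_eq hS' hT hiS' hiT hjT hjS',
      mul_comm]
  · exact ⟨1, fun hi hj S _ hiS hjS => (hij ⟨hi, hj, (ne_of_mem_of_not_mem hiS hjS).symm⟩).elim⟩

end ExchangeRelations

variable {r : Δ → Δ → G₀ˣ} (hr : IsExchangeRatio hU.tripartition U r)
include hr

namespace IsExchangeRatio

theorem ne_zero (hi : i ∈ hU.tripartition.mid) (hj : j ∈ hU.tripartition.mid) (hS : U S ≠ 0)
    (hiS : i ∈ S) (hjS : j ∉ S) : U (exchange S i j) ≠ 0 :=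
  hr hi hj hS hiS hjS ▸ mul_ne_zero (r i j).ne_zero hS

theorem mul_symm (hi : i ∈ hU.tripartition.mid) (hj : j ∈ hU.tripartition.mid) (hij : i ≠ j) :
    r i j * r j i = 1 := by
  obtain ⟨S, hS, hiS, hjS⟩ := hU.exists_separating_of_mem_mid hi hj hij
  have hback := hr hj hi (hr.ne_zero hU hi hj hS hiS hjS) (mem_exchange.2 (Or.inl rfl))
    (notMem_exchange hiS hjS)
  rw [exchange_exchange_self hiS hjS, hr hi hj hS hiS hjS, ← mul_assoc, eq_comm,
    mul_eq_right₀ hS, mul_comm] at hback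
  exact_mod_cast hback

theorem mul_of_notMem (hi : i ∈ hU.tripartition.mid) (hj : j ∈ hU.tripartition.mid)
    (hl : l ∈ hU.tripartition.mid) (hjl : j ≠ l) (hS : U S ≠ 0) (hiS : i ∈ S) (hjS : j ∉ S)
    (hlS : l ∉ S) : r i j * r j l = r i l := by
  have htwo := hr hj hl (hr.ne_zero hU hi hj hS hiS hjS) (mem_exchange.2 (Or.inl rfl))
    fun hmem => (mem_exchange.1 hmem).elim hjl.symm fun hmem => hlS hmem.2
  rw [exchange_exchange hjS, hr hi hj hS hiS hjS, hr hi hl hS hiS hlS, ← mul_assoc,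
    mul_left_inj' hS, mul_comm, eq_comm] at htwo
  exact_mod_cast htwo

theorem mul_of_mem (hi : i ∈ hU.tripartition.mid) (hj : j ∈ hU.tripartition.mid)
    (hl : l ∈ hU.tripartition.mid) (hil : i ≠ l) (hS : U S ≠ 0) (hiS : i ∈ S) (hjS : j ∉ S)
    (hlS : l ∈ S) : r i l * r l j = r i j := by
  have htwo := hr hi hl (hr.ne_zero hU hl hj hS hlS hjS) (mem_exchange.2 (Or.inr ⟨hil, hiS⟩))
    (notMem_exchange hlS hjS)
  rw [exchange_exchange_comm hiS hlS hil hjS, hr hl hj hS hlS hjS, hr hi hj hS hiS hjS,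
    ← mul_assoc, mul_left_inj' hS, eq_comm] at htwo
  exact_mod_cast htwo

theorem mul (hi : i ∈ hU.tripartition.mid) (hj : j ∈ hU.tripartition.mid)
    (hl : l ∈ hU.tripartition.mid) (hij : i ≠ j) (hjl : j ≠ l) (hil : i ≠ l) :
    r i j * r j l = r i l := by
  obtain ⟨S, hS, hiS, hjS⟩ := hU.exists_separating_of_mem_mid hi hj hij
  by_cases hlS : l ∈ S
  · rw [← hr.mul_of_mem hU hi hj hl hil hS hiS hjS hlS, mul_assoc, hr.mul_symm hU hl hj hjl.symm,
      mul_one]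
  · exact hr.mul_of_notMem hU hi hj hl hjl hS hiS hjS hlS

end IsExchangeRatio

omit hr

theorem ExchangeRelations.exists_isExchangeScaling :
    ∃ s, IsExchangeScaling hU.tripartition U s := by
  obtain ⟨r, hr⟩ := hU.exists_isExchangeRatio
  rcases hU.tripartition.mid.eq_empty_or_nonempty with hempty | ⟨b, hb⟩
  · exact ⟨1, fun i hi => by simp [hempty] at hi⟩
  refine ⟨Function.update (r b) b 1, fun i hi j hj S hS hiS hjS => ?_⟩
  have hij := ne_of_mem_of_not_mem hiS hjS
  suffices hs : r i j * Function.update (r b) b 1 i = Function.update (r b) b 1 j by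
    rw [hr hi hj hS hiS hjS, mul_right_comm, ← Units.val_mul, hs, mul_comm]
  rcases eq_or_ne i b with rfl | hib
  · simp [hij.symm]
  rcases eq_or_ne j b with rfl | hjb
  · simp [hij, hr.mul_symm hU hi hj hij]
  · simpa [hib, hjb, mul_comm] using hr.mul hU hb hi hj hib.symm hij hjb.symm

theorem IsExchangeScaling.eq_mul_prod {s : Δ → G₀ˣ}
    (hs : IsExchangeScaling hU.tripartition U s) :
    ∃ α : G₀ˣ, ∀ S, U S ≠ 0 → U S = α * ∏ i ∈ S, (s i : G₀) := by
  obtain ⟨S₀, hS₀⟩ := hU.exists_ne_zero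
  have hprod : ∏ i ∈ S₀, (s i : G₀) ≠ 0 := Finset.prod_ne_zero_iff.2 fun i _ => (s i).ne_zero
  refine ⟨Units.mk0 _ (div_ne_zero hS₀ hprod), fun T hT => ?_⟩
  rw [Units.val_mk0]
  refine (exchange_induction
    (p := fun S => U S ≠ 0 ∧ U S = U S₀ / (∏ i ∈ S₀, (s i : G₀)) * ∏ i ∈ S, (s i : G₀))
    ((hU.card_of_ne_zero hS₀).trans (hU.card_of_ne_zero hT).symm)
    ⟨hS₀, (div_mul_cancel₀ _ hprod).symm⟩ fun S ⟨hS, heq⟩ i hi j hj => ?_).2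
  obtain ⟨hiS, hiT⟩ := Finset.mem_sdiff.1 hi
  obtain ⟨hjT, hjS⟩ := Finset.mem_sdiff.1 hj
  refine ⟨hU.exchange_ne_zero hS hT hiS hiT hjT hjS, mul_right_cancel₀ (s i).ne_zero ?_⟩
  rw [hs (hU.mem_mid_iff.2 ⟨⟨S, hS, hiS⟩, T, hT, hiT⟩)
    (hU.mem_mid_iff.2 ⟨⟨T, hT, hjT⟩, S, hS, hjS⟩) hS hiS hjS, mul_assoc,
    prod_exchange_mul hiS hjS, ← mul_assoc, ← heq]

end Scaling

theorem exists_eqOn_pow_mul_pow_eq {Δ G : Type*} [CommGroup G] {m n : ℕ}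
    (hm : Function.Surjective fun x : G => x ^ m) (hn : Function.Surjective fun x : G => x ^ n)
    {E F : Set Δ} {s₀ t₀ : Δ → G}
    (h : ∀ i ∈ E ∩ F, ∀ j ∈ E ∩ F, s₀ i ^ m * t₀ j ^ n = s₀ j ^ m * t₀ i ^ n) :
    ∃ s t, Set.EqOn s s₀ E ∧ Set.EqOn t t₀ F ∧
      ∀ i j, s i ^ m * t j ^ n = s j ^ m * t i ^ n := by
  classical
  obtain ⟨κ, hκ⟩ : ∃ κ : G, ∀ i ∈ E ∩ F, s₀ i ^ m = κ * t₀ i ^ n := by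
    rcases (E ∩ F).eq_empty_or_nonempty with hempty | ⟨j, hj⟩
    · exact ⟨1, by simp [hempty]⟩
    · refine ⟨s₀ j ^ m / t₀ j ^ n, fun i hi => ?_⟩
      rw [div_mul_eq_mul_div, eq_div_iff_mul_eq', h i hi j hj]
  choose rootₘ hrootₘ using hm
  choose rootₙ hrootₙ using hn
  let t := F.piecewise t₀ fun i => rootₙ (s₀ i ^ m / κ)
  let s := E.piecewise s₀ fun i => rootₘ (κ * t i ^ n)
  have hst : ∀ i, s i ^ m = κ * t i ^ n := by
    intro i
    by_cases hiE : i ∈ E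
    · by_cases hiF : i ∈ F
      · simp [s, t, hiE, hiF, hκ i ⟨hiE, hiF⟩]
      · simp only [s, t, Set.piecewise_eq_of_mem E _ _ hiE, Set.piecewise_eq_of_notMem F _ _ hiF]
        rw [show rootₙ (s₀ i ^ m / κ) ^ n = _ from hrootₙ _, mul_div_cancel]
    · simpa [s, hiE] using hrootₘ (κ * t i ^ n)
  refine ⟨s, t, E.piecewise_eqOn _ _, F.piecewise_eqOn _ _,
    fun i j => ?_⟩
  rw [hst, hst, mul_right_comm]

section MixedRelations

variable {Δ : Type*} [DecidableEq Δ] {G₀ : Type*} [CommGroupWithZero G₀] {I J : Finset Δ}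
  {h₁ h₂ m n : ℕ} {U₁ U₂ : Finset Δ → G₀}

/-- The relations between `U₁` and `U₂` under opposite exchanges of two elements of `I ∩ J`; they
hold for monomials in variables `s` and `t` with `s i ^ m * t j ^ n = s j ^ m * t i ^ n`. -/
def MixedRelations (I J : Finset Δ) (m n : ℕ) (U₁ U₂ : Finset Δ → G₀) : Prop :=
  ∀ ⦃i⦄, i ∈ I ∩ J → ∀ ⦃j⦄, j ∈ I ∩ J → ∀ ⦃S T⦄, U₁ S ≠ 0 → U₂ T ≠ 0 → i ∈ S → j ∉ S → j ∈ T →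
    i ∉ T → U₁ S ^ m * U₂ T ^ n = U₁ (exchange S i j) ^ m * U₂ (exchange T j i) ^ n

namespace MixedRelations

variable (hmix : MixedRelations I J m n U₁ U₂) (hU₁ : ExchangeRelations I h₁ U₁)
  (hU₂ : ExchangeRelations J h₂ U₂)
include hmix hU₁ hU₂

theorem notMem_of_notMem (hm : m ≠ 0) (hn : n ≠ 0) {i j : Δ} (hi : i ∈ I ∩ J) (hj : j ∈ I ∩ J)
    (hij : i ≠ j) (hiA : i ∉ hU₁.tripartition.lst) (hiB : i ∉ hU₂.tripartition.fst)
    (hjA : j ∉ hU₁.tripartition.fst) (hjB : j ∉ hU₂.tripartition.lst) :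
    (i ∉ hU₁.tripartition.fst ∧ j ∉ hU₁.tripartition.lst) ∧
      i ∉ hU₂.tripartition.lst ∧ j ∉ hU₂.tripartition.fst := by
  obtain ⟨hiI, hiJ⟩ := Finset.mem_inter.1 hi
  obtain ⟨hjI, hjJ⟩ := Finset.mem_inter.1 hj
  obtain ⟨S, hS, hiS, hjS⟩ := hU₁.exists_separating hiI hjI hij hiA hjA
  obtain ⟨T, hT, hjT, hiT⟩ := hU₂.exists_separating hjJ hiJ hij.symm hjB hiB
  have hne := hmix hi hj hS hT hiS hjS hjT hiT ▸
    mul_ne_zero (pow_ne_zero m hS) (pow_ne_zero n hT)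
  obtain ⟨hne₁, hne₂⟩ := mul_ne_zero_iff.1 hne
  obtain ⟨hb₁, -⟩ := (hU₁.hasSupport_tripartition _).1 (ne_zero_pow hm hne₁)
  obtain ⟨hb₂, -⟩ := (hU₂.hasSupport_tripartition _).1 (ne_zero_pow hn hne₂)
  exact ⟨⟨fun hi => notMem_exchange hiS hjS (hb₁.1 hi),
    hb₁.notMem_lst (mem_exchange.2 (Or.inl rfl))⟩, hb₂.notMem_lst (mem_exchange.2 (Or.inl rfl)),
    fun hj => notMem_exchange hjT hiT (hb₂.1 hj)⟩

theorem compatible_tripartition (hm : m ≠ 0) (hn : n ≠ 0) :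
    Compatible hU₁.tripartition hU₂.tripartition := by
  rw [compatible_iff, or_iff_not_imp_right, not_or]
  rintro ⟨hAB, hBA⟩
  simp only [Above, not_forall, not_or] at hAB hBA
  obtain ⟨i, hi, hiB, hiA⟩ := hAB
  obtain ⟨j, hj, hjA, hjB⟩ := hBA
  rw [Finset.inter_comm] at hj
  intro l hl
  have hil := fun hne => hmix.notMem_of_notMem hU₁ hU₂ hm hn hi hl hne hiA hiB
  have hlj := fun hne hlA hlB => hmix.notMem_of_notMem hU₁ hU₂ hm hn hl hj hne hlA hlB hjA hjB
  refine ⟨⟨fun hlA => ?_, fun hlB => ?_⟩, fun hlA => ?_, fun hlB => ?_⟩ <;> by_contra hnot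
  · exact (hlj (ne_of_mem_of_not_mem hlA hjA) (Tripartition.notMem_lst_of_mem_fst hlA)
      hnot).1.1 hlA
  · exact (hil (ne_of_mem_of_not_mem hlB hiB).symm hnot
      (Tripartition.notMem_lst_of_mem_fst hlB)).2.2 hlB
  · exact (hil (ne_of_mem_of_not_mem hlA hiA).symm
      (fun hfst => Tripartition.notMem_lst_of_mem_fst hfst hlA) hnot).1.2 hlA
  · exact (hlj (ne_of_mem_of_not_mem hlB hjB) hnot
      fun hfst => Tripartition.notMem_lst_of_mem_fst hfst hlB).2.1 hlB

theorem exists_compatible (hm : m ≠ 0) (hn : n ≠ 0) (h₁pos : 0 < h₁) (h₂pos : 0 < h₂) :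
    ∃ (A : Tripartition I) (B : Tripartition J), A.Bounds h₁ ∧ B.Bounds h₂ ∧ Compatible A B ∧
      HasSupport U₁ h₁ A ∧ HasSupport U₂ h₂ B := by
  have hcomp := hmix.compatible_tripartition hU₁ hU₂ hm hn
  obtain ⟨A, hA, hsA, hAB⟩ := hU₁.exists_bounds_compatible h₁pos hcomp
  obtain ⟨B, hB, hsB, hBA⟩ := hU₂.exists_bounds_compatible h₂pos hAB.symm
  exact ⟨A, B, hA, hB, hBA.symm, hsA, hsB⟩

theorem pow_mul_pow_eq {s t : Δ → G₀ˣ} (hs : IsExchangeScaling hU₁.tripartition U₁ s)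
    (ht : IsExchangeScaling hU₂.tripartition U₂ t) {i j : Δ}
    (hi : i ∈ hU₁.tripartition.mid ∩ hU₂.tripartition.mid)
    (hj : j ∈ hU₁.tripartition.mid ∩ hU₂.tripartition.mid) :
    s i ^ m * t j ^ n = s j ^ m * t i ^ n := by
  rcases eq_or_ne i j with rfl | hij
  · rfl
  obtain ⟨hiA, hiB⟩ := Finset.mem_inter.1 hi
  obtain ⟨hjA, hjB⟩ := Finset.mem_inter.1 hj
  obtain ⟨S, hS, hiS, hjS⟩ := hU₁.exists_separating_of_mem_mid hiA hjA hij
  obtain ⟨T, hT, hjT, hiT⟩ := hU₂.exists_separating_of_mem_mid hjB hiB hij.symm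
  have hmid := Finset.inter_subset_inter hU₁.tripartition.mid_subset hU₂.tripartition.mid_subset
  have hrel := hmix (hmid hi) (hmid hj) hS hT hiS hjS hjT hiT
  have hne := mul_ne_zero (pow_ne_zero m hS) (pow_ne_zero n hT)
  ext
  push_cast
  refine mul_left_cancel₀ hne ?_
  calc U₁ S ^ m * U₂ T ^ n * (s i ^ m * t j ^ n)
      = (U₁ (exchange S i j) * s i) ^ m * (U₂ (exchange T j i) * t j) ^ n := by
        rw [hrel, mul_pow, mul_pow, mul_mul_mul_comm]
    _ = U₁ S ^ m * U₂ T ^ n * (s j ^ m * t i ^ n) := by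
        rw [hs hiA hjA hS hiS hjS, ht hjB hiB hT hjT hiT, mul_pow, mul_pow, mul_mul_mul_comm]

theorem exists_scaling (hm : Function.Surjective fun x : G₀ˣ => x ^ m)
    (hn : Function.Surjective fun x : G₀ˣ => x ^ n) :
    ∃ (s t : Δ → G₀ˣ) (α β : G₀ˣ), (∀ i j, s i ^ m * t j ^ n = s j ^ m * t i ^ n) ∧
      (∀ S, U₁ S ≠ 0 → U₁ S = α * ∏ i ∈ S, (s i : G₀)) ∧
      ∀ T, U₂ T ≠ 0 → U₂ T = β * ∏ i ∈ T, (t i : G₀) := by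
  obtain ⟨s₀, hs₀⟩ := hU₁.exists_isExchangeScaling
  obtain ⟨t₀, ht₀⟩ := hU₂.exists_isExchangeScaling
  obtain ⟨s, t, hs, ht, hst⟩ := exists_eqOn_pow_mul_pow_eq hm hn fun i hi j hj =>
    hmix.pow_mul_pow_eq hU₁ hU₂ hs₀ ht₀ (Finset.mem_inter.2 hi) (Finset.mem_inter.2 hj)
  obtain ⟨α, hα⟩ := (hs₀.congr hs).eq_mul_prod hU₁
  obtain ⟨β, hβ⟩ := (ht₀.congr ht).eq_mul_prod hU₂
  exact ⟨s, t, α, β, hst, hα, hβ⟩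

end MixedRelations

end MixedRelations

section OrbitClosure

variable {k : Type*} [Field k] {Δ : Type*} {I J : Finset Δ} {h₁ h₂ : ℕ}
  {V V' : Gr k I h₁} {W W' : Gr k J h₂}
  {T : Subgroup ((I → kˣ) × (J → kˣ))} {m m' : (Fin h₁ ↪ I) ⊕ (Fin h₂ ↪ J) →₀ ℕ}

theorem prod_plucker_mul_eq_of_mem_closure
    (hP : (V', W') ∈ @closure _ (zariski k I J h₁ h₂) (orbit T (V, W)))
    (hdeg : Finsupp.weight (Sum.elim (fun _ => ((1, 0) : ℕ × ℕ)) fun _ => (0, 1)) m =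
      Finsupp.weight (Sum.elim (fun _ => ((1, 0) : ℕ × ℕ)) fun _ => (0, 1)) m')
    (hT : ∀ p ∈ T, (m.prod fun c n => Sum.elim (torusChar p.1) (torusChar p.2) c ^ n) =
      m'.prod fun c n => Sum.elim (torusChar p.1) (torusChar p.2) c ^ n) :
    (m.prod fun c n => Sum.elim (plucker V') (plucker W') c ^ n) *
        (m'.prod fun c n => Sum.elim (plucker V) (plucker W) c ^ n) =
      (m'.prod fun c n => Sum.elim (plucker V') (plucker W') c ^ n) *
        (m.prod fun c n => Sum.elim (plucker V) (plucker W) c ^ n) := by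
  set x := Sum.elim (plucker V) (plucker W)
  have hbihom : IsBihomogeneous k I J h₁ h₂ (MvPolynomial.monomial m (m'.prod fun c n => x c ^ n) -
      MvPolynomial.monomial m' (m.prod fun c n => x c ^ n)) :=
    ⟨_, _, (MvPolynomial.weightedHomogeneousSubmodule k _ _).sub_mem
      (MvPolynomial.isWeightedHomogeneous_monomial _ _ _ hdeg)
      (MvPolynomial.isWeightedHomogeneous_monomial _ _ _ rfl)⟩
  have hzero := mem_closure_zariski_iff.1 hP _ hbihom (by
    rintro _ ⟨p, hp, rfl⟩
    have hact : Sum.elim (fun c => (torusChar p.1 c : k) * plucker V c)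
        (fun c => (torusChar p.2 c : k) * plucker W c) =
        fun c => (Sum.elim (torusChar p.1) (torusChar p.2) c : kˣ) * x c := by
      ext (c | c) <;> rfl
    have hchar := congrArg (Units.coeHom k) (hT p hp)
    simp only [map_finsuppProd, map_pow, Units.coeHom_apply] at hchar
    refine (hbihom.eval_eq_zero_iff (P := (act p.1 V, act p.2 W))
      ((isPluckerVector_plucker V).act p.1) ((isPluckerVector_plucker W).act p.2)).2 ?_
    rw [hact]
    simp only [map_sub, MvPolynomial.eval_monomial, mul_pow, Finsupp.prod_mul, hchar]
    ring)
  simp only [map_sub, MvPolynomial.eval_monomial, sub_eq_zero] at hzero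
  rw [mul_comm, hzero, mul_comm]

theorem prod_plucker_div_eq_of_mem_closure
    (hP : (V', W') ∈ @closure _ (zariski k I J h₁ h₂) (orbit T (V, W)))
    (hV : ∀ c, plucker V c ≠ 0) (hW : ∀ c, plucker W c ≠ 0)
    (hdeg : Finsupp.weight (Sum.elim (fun _ => ((1, 0) : ℕ × ℕ)) fun _ => (0, 1)) m =
      Finsupp.weight (Sum.elim (fun _ => ((1, 0) : ℕ × ℕ)) fun _ => (0, 1)) m')
    (hT : ∀ p ∈ T, (m.prod fun c n => Sum.elim (torusChar p.1) (torusChar p.2) c ^ n) =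
      m'.prod fun c n => Sum.elim (torusChar p.1) (torusChar p.2) c ^ n) :
    (m.prod fun c n => Sum.elim (fun c => plucker V' c / plucker V c)
        (fun c => plucker W' c / plucker W c) c ^ n) =
      m'.prod fun c n => Sum.elim (fun c => plucker V' c / plucker V c)
        (fun c => plucker W' c / plucker W c) c ^ n := by
  have hne : ∀ l : (Fin h₁ ↪ I) ⊕ (Fin h₂ ↪ J) →₀ ℕ,
      (l.prod fun c n => Sum.elim (plucker V) (plucker W) c ^ n) ≠ 0 := fun l =>
    Finset.prod_ne_zero_iff.2 fun c _ => pow_ne_zero _ (by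
      cases c
      exacts [hV _, hW _])
  have hdiv : Sum.elim (fun c => plucker V' c / plucker V c) (fun c => plucker W' c / plucker W c) =
      fun c => Sum.elim (plucker V') (plucker W') c / Sum.elim (plucker V) (plucker W) c := by
    ext (c | c) <;> rfl
  simp only [hdiv, div_pow, Finsupp.prod, Finset.prod_div_distrib]
  exact (div_eq_div_iff (hne m) (hne m')).2 (prod_plucker_mul_eq_of_mem_closure hP hdeg hT)

end OrbitClosure

section Powers

variable {G₀ : Type*} [GroupWithZero G₀] {n : ℕ}

theorem ne_zero_of_surjective_pow (hn : Function.Surjective fun x : G₀ => x ^ n) : n ≠ 0 := by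
  rintro rfl
  obtain ⟨x, hx⟩ := hn 0
  simp at hx

theorem surjective_units_pow (hn : Function.Surjective fun x : G₀ => x ^ n) :
    Function.Surjective fun x : G₀ˣ => x ^ n := by
  intro u
  obtain ⟨x, hx : x ^ n = u⟩ := hn u
  have hx₀ : x ≠ 0 := ne_zero_pow (ne_zero_of_surjective_pow hn) (hx ▸ u.ne_zero)
  exact ⟨Units.mk0 x hx₀, Units.ext hx⟩

end Powers

section PluckerRatio

variable {k : Type*} [Field k] {Δ : Type*} {I J : Finset Δ} {h h₁ h₂ lam tau : ℕ}

theorem torusChar_eq_prod_extend (s : I → kˣ) (c : Fin h ↪ I) :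
    torusChar s c = ∏ x ∈ cols c, Function.extend Subtype.val s 1 x := by
  rw [prod_cols]
  exact Finset.prod_congr rfl fun i _ => (Subtype.val_injective.extend_apply s 1 (c i)).symm

variable [DecidableEq Δ]

theorem torusChar_mul_of_cols_eq_exchange {c c' : Fin h ↪ I} {i j : I} (hi : ↑i ∈ cols c)
    (hj : ↑j ∉ cols c) (hc' : cols c' = exchange (cols c) i j) (s : I → kˣ) :
    torusChar s c' * s i = torusChar s c * s j := by
  rw [torusChar_eq_prod_extend, torusChar_eq_prod_extend, hc',
    ← Subtype.val_injective.extend_apply s 1 i, ← Subtype.val_injective.extend_apply s 1 j,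
    prod_exchange_mul hi hj]

theorem torusChar_pow_mul_pow_of_exchange {p : (I → kˣ) × (J → kˣ)}
    (hp : p ∈ torus k I J lam tau) {c c' : Fin h₁ ↪ I} {d d' : Fin h₂ ↪ J} {i j : Δ}
    (hic : i ∈ cols c) (hjc : j ∉ cols c) (hjd : j ∈ cols d) (hid : i ∉ cols d)
    (hiJ : i ∈ J) (hjI : j ∈ I)
    (hc' : cols c' = exchange (cols c) i j) (hd' : cols d' = exchange (cols d) j i) :
    torusChar p.1 c ^ tau * torusChar p.2 d ^ lam =
      torusChar p.1 c' ^ tau * torusChar p.2 d' ^ lam := by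
  have hiI := cols_subset c hic
  have hjJ := cols_subset d hjd
  refine mul_right_cancel (b := p.1 ⟨i, hiI⟩ ^ tau * p.2 ⟨j, hjJ⟩ ^ lam) ?_
  symm
  calc torusChar p.1 c' ^ tau * torusChar p.2 d' ^ lam *
        (p.1 ⟨i, hiI⟩ ^ tau * p.2 ⟨j, hjJ⟩ ^ lam)
      = (torusChar p.1 c' * p.1 ⟨i, hiI⟩) ^ tau * (torusChar p.2 d' * p.2 ⟨j, hjJ⟩) ^ lam := by
        rw [mul_pow, mul_pow, mul_mul_mul_comm]
    _ = (torusChar p.1 c * p.1 ⟨j, hjI⟩) ^ tau * (torusChar p.2 d * p.2 ⟨i, hiJ⟩) ^ lam := by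
        rw [torusChar_mul_of_cols_eq_exchange hic (j := ⟨j, hjI⟩) hjc hc',
          torusChar_mul_of_cols_eq_exchange hjd (j := ⟨i, hiJ⟩) hid hd']
    _ = torusChar p.1 c ^ tau * torusChar p.2 d ^ lam *
        (p.1 ⟨i, hiI⟩ ^ tau * p.2 ⟨j, hjJ⟩ ^ lam) := by
        rw [mul_pow, mul_pow, mul_mul_mul_comm, ← hp i j hiI hiJ hjI hjJ]

theorem exchangeRelations_pluckerRatio {V V' : Gr k I h} (hV : ∀ c, plucker V c ≠ 0)
    (hrel : ∀ c d c' d' : Fin h ↪ I,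
      (∀ s : I → kˣ, torusChar s c * torusChar s d = torusChar s c' * torusChar s d') →
      plucker V' c / plucker V c * (plucker V' d / plucker V d) =
        plucker V' c' / plucker V c' * (plucker V' d' / plucker V d')) :
    ExchangeRelations I h (pluckerRatio V V') where
  subset_of_ne_zero hS := by
    obtain ⟨c, rfl⟩ := exists_cols_of_pluckerRatio_ne_zero hS
    exact cols_subset c
  card_of_ne_zero hS := by
    obtain ⟨c, rfl⟩ := exists_cols_of_pluckerRatio_ne_zero hS
    exact card_cols c
  exists_ne_zero := by
    obtain ⟨c, hc⟩ := exists_plucker_ne_zero V'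
    exact ⟨cols c, pluckerRatio_cols V V' c ▸ div_ne_zero hc (hV c)⟩
  mul_eq hS hT hiS hiT hjT hjS := by
    obtain ⟨c, rfl⟩ := exists_cols_of_pluckerRatio_ne_zero hS
    obtain ⟨d, rfl⟩ := exists_cols_of_pluckerRatio_ne_zero hT
    obtain ⟨c', hc'⟩ := exists_cols_eq (exchange_subset (cols_subset c) (cols_subset d hjT))
      ((card_exchange hiS hjS).trans (card_cols c))
    obtain ⟨d', hd'⟩ := exists_cols_eq (exchange_subset (cols_subset d) (cols_subset c hiS))
      ((card_exchange hjT hiT).trans (card_cols d))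
    rw [← hc', ← hd']
    simp only [pluckerRatio_cols]
    refine hrel c d c' d' fun s => ?_
    have hss : (s, s) ∈ torus k I I 1 1 := fun i j _ _ _ _ => by simp [mul_comm]
    simpa using torusChar_pow_mul_pow_of_exchange hss hiS hjS hjT hiT (cols_subset c hiS)
      (cols_subset d hjT) hc' hd'

variable {V V' : Gr k I h₁} {W W' : Gr k J h₂}

theorem exchangeRelations_pluckerRatio_fst {T : Subgroup ((I → kˣ) × (J → kˣ))}
    (hP : (V', W') ∈ @closure _ (zariski k I J h₁ h₂) (orbit T (V, W)))
    (hV : ∀ c, plucker V c ≠ 0) (hW : ∀ c, plucker W c ≠ 0) :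
    ExchangeRelations I h₁ (pluckerRatio V V') := by
  refine exchangeRelations_pluckerRatio hV fun c d c' d' hchar => ?_
  have hrel := prod_plucker_div_eq_of_mem_closure hP hV hW
    (m := .single (.inl c) 1 + .single (.inl d) 1)
    (m' := .single (.inl c') 1 + .single (.inl d') 1)
    (by simp [Finsupp.weight_single]) fun p _ => by
      simpa [Finsupp.prod_add_index', pow_add] using hchar p.1
  simpa [Finsupp.prod_add_index', pow_add] using hrel

theorem exchangeRelations_pluckerRatio_snd {T : Subgroup ((I → kˣ) × (J → kˣ))}
    (hP : (V', W') ∈ @closure _ (zariski k I J h₁ h₂) (orbit T (V, W)))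
    (hV : ∀ c, plucker V c ≠ 0) (hW : ∀ c, plucker W c ≠ 0) :
    ExchangeRelations J h₂ (pluckerRatio W W') := by
  refine exchangeRelations_pluckerRatio hW fun c d c' d' hchar => ?_
  have hrel := prod_plucker_div_eq_of_mem_closure hP hV hW
    (m := .single (.inr c) 1 + .single (.inr d) 1)
    (m' := .single (.inr c') 1 + .single (.inr d') 1)
    (by simp [Finsupp.weight_single]) fun p _ => by
      simpa [Finsupp.prod_add_index', pow_add] using hchar p.2
  simpa [Finsupp.prod_add_index', pow_add] using hrel

theorem mixedRelations_pluckerRatio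
    (hP : (V', W') ∈ @closure _ (zariski k I J h₁ h₂) (orbit (torus k I J lam tau) (V, W)))
    (hV : ∀ c, plucker V c ≠ 0) (hW : ∀ c, plucker W c ≠ 0) :
    MixedRelations I J tau lam (pluckerRatio V V') (pluckerRatio W W') := by
  intro i hi j hj S T hS hT hiS hjS hjT hiT
  have hiJ := (Finset.mem_inter.1 hi).2
  have hjI := (Finset.mem_inter.1 hj).1
  obtain ⟨c, rfl⟩ := exists_cols_of_pluckerRatio_ne_zero hS
  obtain ⟨d, rfl⟩ := exists_cols_of_pluckerRatio_ne_zero hT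
  obtain ⟨c', hc'⟩ := exists_cols_eq (exchange_subset (cols_subset c) hjI)
    ((card_exchange hiS hjS).trans (card_cols c))
  obtain ⟨d', hd'⟩ := exists_cols_eq (exchange_subset (cols_subset d) hiJ)
    ((card_exchange hjT hiT).trans (card_cols d))
  have hrel := prod_plucker_div_eq_of_mem_closure hP hV hW
    (m := .single (.inl c) tau + .single (.inr d) lam)
    (m' := .single (.inl c') tau + .single (.inr d') lam)
    (by simp [Finsupp.weight_single]) fun p hp => by
      simpa [Finsupp.prod_add_index', pow_add] using
        torusChar_pow_mul_pow_of_exchange hp hiS hjS hjT hiT hiJ hjI hc' hd'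
  rw [← hc', ← hd']
  simpa [Finsupp.prod_add_index', pow_add, pluckerRatio_cols] using hrel

theorem eq_act_degeneration {V V' : Gr k I h} (hV : ∀ c, plucker V c ≠ 0) {A : Tripartition I}
    (hsupp : HasSupport (pluckerRatio V V') h A) {s : Δ → kˣ} {α : kˣ}
    (hs : ∀ S, pluckerRatio V V' S ≠ 0 → pluckerRatio V V' S = α * ∏ i ∈ S, (s i : k))
    (hd : finrank k (degeneration V.1 A) = h) :
    V' = act (fun i : I => s i) ⟨degeneration V.1 A, hd⟩ := by
  have hplucker : ∀ c, plucker V' c = pluckerRatio V V' (cols c) * plucker V c := fun c => by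
    rw [pluckerRatio_cols, div_mul_cancel₀ _ (hV c)]
  obtain ⟨c, hc⟩ := exists_plucker_ne_zero V'
  have hAc := ((hsupp _).1 (left_ne_zero_of_mul (hplucker c ▸ hc))).1
  refine IsPluckerVector.eq ⟨α, fun c' => ?_⟩
    ((isPluckerVector_degeneration (hV c) hAc hd).act fun i : I => s i)
  rw [hplucker]
  by_cases hA : c' ∈ {c' | A.Between (cols c')}
  · rw [hs _ ((hsupp _).2 ⟨hA, card_cols c'⟩), prod_cols, Set.indicator_of_mem hA, torusChar,
      Units.coe_prod, mul_assoc]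
  · rw [not_not.1 (mt (hsupp _).1 fun h => hA h.1), Set.indicator_of_notMem hA, zero_mul,
      mul_zero, mul_zero]

theorem exists_mem_orbit_degeneration (hlam : Function.Surjective fun x : k => x ^ lam)
    (htau : Function.Surjective fun x : k => x ^ tau) (h₁pos : 0 < h₁) (h₂pos : 0 < h₂)
    (hP : (V', W') ∈ @closure _ (zariski k I J h₁ h₂) (orbit (torus k I J lam tau) (V, W)))
    (hV : ∀ c, plucker V c ≠ 0) (hW : ∀ c, plucker W c ≠ 0) :
    ∃ (A : Tripartition I) (B : Tripartition J), A.Bounds h₁ ∧ B.Bounds h₂ ∧ Compatible A B ∧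
      ∀ dimV dimW, (V', W') ∈ orbit (torus k I J lam tau)
        (⟨degeneration V.1 A, dimV⟩, ⟨degeneration W.1 B, dimW⟩) := by
  have hU₁ := exchangeRelations_pluckerRatio_fst hP hV hW
  have hU₂ := exchangeRelations_pluckerRatio_snd hP hV hW
  have hmix := mixedRelations_pluckerRatio hP hV hW
  obtain ⟨A, B, hA, hB, hAB, hsA, hsB⟩ := hmix.exists_compatible hU₁ hU₂
    (ne_zero_of_surjective_pow htau) (ne_zero_of_surjective_pow hlam) h₁pos h₂pos
  obtain ⟨s, t, α, β, hst, hs, ht⟩ := hmix.exists_scaling hU₁ hU₂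
    (surjective_units_pow htau) (surjective_units_pow hlam)
  exact ⟨A, B, hA, hB, hAB, fun dimV dimW => ⟨(fun i => s i, fun i => t i),
    fun i j _ _ _ _ => hst i j, Prod.ext (eq_act_degeneration hV hsA hs dimV)
      (eq_act_degeneration hW hsB ht dimW)⟩⟩

end PluckerRatio

end GrassOrbit

end

open GrassOrbit

theorem lemma9p2_general {k : Type*} [Field k] [Infinite k] {Δ : Type*} [DecidableEq Δ]
    (I J : Finset Δ) (h₁ h₂ : ℕ) (V : Gr k I h₁) (W : Gr k J h₂)
    (hV0 : V.1 ≠ ⊥) (hW0 : W.1 ≠ ⊥)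
    (lam tau : ℕ) (hlam : Function.Surjective fun x : k => x ^ lam)
    (htau : Function.Surjective fun x : k => x ^ tau)
    (hV : ∀ b : Fin h₁ ↪ I, plucker V b ≠ 0)
    (hW : ∀ c : Fin h₂ ↪ J, plucker W c ≠ 0) :
    ∃ (dimV : ∀ A : Tripartition I, A.Bounds h₁ →
          Module.finrank k (degeneration V.1 A) = h₁)
      (dimW : ∀ B : Tripartition J, B.Bounds h₂ →
          Module.finrank k (degeneration W.1 B) = h₂),
      @closure _ (zariski k I J h₁ h₂) (orbit (torus k I J lam tau) (V, W)) =
        ⋃ (A : Tripartition I) (B : Tripartition J) (hA : A.Bounds h₁) (hB : B.Bounds h₂)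
          (_ : Compatible A B),
          orbit (torus k I J lam tau)
            (⟨degeneration V.1 A, dimV A hA⟩, ⟨degeneration W.1 B, dimW B hB⟩) := by
  have h₁pos := Nat.pos_of_ne_zero fun h => hV0 (Submodule.finrank_eq_zero.1 (V.2.trans h))
  have h₂pos := Nat.pos_of_ne_zero fun h => hW0 (Submodule.finrank_eq_zero.1 (W.2.trans h))
  refine ⟨fun A hA => ?_, fun B hB => ?_, Set.Subset.antisymm ?_ ?_⟩
  · obtain ⟨c, hc⟩ := hA.exists_cols
    exact finrank_degeneration (hV c) hc
  · obtain ⟨c, hc⟩ := hB.exists_cols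
    exact finrank_degeneration (hW c) hc
  · intro P hP
    obtain ⟨A, B, hA, hB, hAB, horbit⟩ :=
      exists_mem_orbit_degeneration hlam htau h₁pos h₂pos hP hV hW
    simp only [Set.mem_iUnion]
    exact ⟨A, B, hA, hB, hAB, horbit _ _⟩
  · simp only [Set.iUnion_subset_iff]
    rintro A B hA hB hAB _ ⟨p, hp, rfl⟩
    obtain ⟨c, hc⟩ := hA.exists_cols
    obtain ⟨c', hc'⟩ := hB.exists_cols
    exact degeneration_mem_closure (Nat.pos_of_ne_zero (ne_zero_of_surjective_pow hlam))
      (Nat.pos_of_ne_zero (ne_zero_of_surjective_pow htau)) hAB (hV c) hc (hW c') hc' _ _ hp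

theorem lemma9p2 {k : Type*} [Field k] [IsAlgClosed k] {Δ : Type*} [DecidableEq Δ]
    (I J : Finset Δ) (h₁ h₂ : ℕ) (V : Gr k I h₁) (W : Gr k J h₂)
    (hV0 : V.1 ≠ ⊥) (hW0 : W.1 ≠ ⊥)
    (lam tau : ℕ) (hlam : 0 < lam) (htau : 0 < tau)
    (hV : ∀ b : Fin h₁ ↪ I, plucker V b ≠ 0)
    (hW : ∀ c : Fin h₂ ↪ J, plucker W c ≠ 0) :
    ∃ (dimV : ∀ A : Tripartition I, A.Bounds h₁ →
          Module.finrank k (degeneration V.1 A) = h₁)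
      (dimW : ∀ B : Tripartition J, B.Bounds h₂ →
          Module.finrank k (degeneration W.1 B) = h₂),
      @closure _ (zariski k I J h₁ h₂) (orbit (torus k I J lam tau) (V, W)) =
        ⋃ (A : Tripartition I) (B : Tripartition J) (hA : A.Bounds h₁) (hB : B.Bounds h₂)
          (_ : Compatible A B),
          orbit (torus k I J lam tau)
            (⟨degeneration V.1 A, dimV A hA⟩, ⟨degeneration W.1 B, dimW B hB⟩) := by
  have := IsAlgClosed.instInfinite (K := k)
  exact lemma9p2_general I J h₁ h₂ V W hV0 hW0 lam tau
    (fun x => IsAlgClosed.exists_pow_nat_eq x hlam) (fun x => IsAlgClosed.exists_pow_nat_eq x htau)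
    hV hW
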